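/- Let $\mathcal M$ be a simple matroid (no loops and no two parallel elements) on a finite totally ordered ground set $E$ (for instance $E=[n]$), let $\mathbb K$ be a field, and let $\beta_{i,j}\in\mathbb K^*$ for $i<j$. For $S\subseteq E$ let $\mathcal E(S)$ be the unital associative $\mathbb K$-algebra generated by $e_i$ ($i\in S$) with relations $e_i^2=0$ and $e_je_i=\beta_{i,j}e_ie_j$ for $i<j$; for $X=\{i_1<\dots<i_m\}$ put $e_X=e_{i_1}\cdots e_{i_m}$, $e_\emptyset=1$. Let $\chi:2^{E}\to\mathbb K$; on ordered sets put $\chi(X^\sigma)=\operatorname{sgn}(\sigma)\chi(X)$. The $\chi$-boundary is $\partial e_X=\sum_{p=1}^m(-1)^p\chi(X\setminus i_p)\,e_{X\setminus i_p}$, with the convention $\partial e_i=1$. For a matroid $\mathcal N$ on $S\subseteq E$ with a map $\chi$ on $2^S$, call a subset of $S$ unidependent if it contains exactly one circuit, and call $\chi$ admissible for $\mathcal N$ if (1) for $I\subseteq S$, $\chi(I)\neq0$ if and only if $I$ is independent, and (2) for all unidependent $U'\subseteq U$ there is $\varepsilon\in\mathbb K^*$ with $\partial e_U=\varepsilon\,(\partial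 e_{U'})\,e_{U\setminus U'}$ in $\mathcal E(S)$. The $\chi$-algebra is the quotient $\mathbb A_\chi(\mathcal N)=\mathcal E(S)/\Im_\chi(\mathcal N)$, where $\Im_\chi(\mathcal N)$ is the right ideal generated by $\partial e_C$ for the circuits $C$ with $|C|>1$ and by $e_i$ for the loops $i$. Classes of $e_X$ are again denoted $e_X$. **Theorem.** Let $\chi$ be admissible for $\mathcal M$ and let $x\in E$. Then the restriction of $\chi$ to $2^{E\setminus x}$ is admissible for $\mathcal M\setminus x$, and $\chi_{\mathcal M/x}(X):=\chi(X\circ x)$ ($x$ appended at the end of $X$) is admissible for $\mathcal M/x$. Denote by $\mathbb A(\mathcal M)$, $\mathbb A(\mathcal M\setminus x)$, $\mathbb A(\mathcal M/x)$ the corresponding $\chi$-algebras. There is a unique linear map $\mathfrak i_x:\mathbb A(\mathcal M\setminus x)\to\mathbb A(\mathcal M)$ with $\mathfrak i_x(e_I)=e_I$ for every independent set $I$ of $\mathcal M\setminus x$, and a unique linear map $\mathfrak p_x:\mathbb A(\mathcal M)\to\mathbb A(\mathcal M/x)$ such that for every independent set $I$ of $\mathcal M$ $$\mathfrak p_x(e_I)=\begin{cases}e_{I\setminus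 x}&\text{if }x\in I,\\ \dfrac{\chi(I\setminus y\circ x)}{\chi(I\setminus y\circ y)}\,e_{I\setminus y}&\text{if some }y\in I\text{ is parallel to }x,\\ 0&\text{otherwise}\end{cases}$$ (the second case does not occur, since $\mathcal M$ is simple). The sequence of vector spaces $$0\to\mathbb A(\mathcal M\setminus x)\xrightarrow{\ \mathfrak i_x\ }\mathbb A(\mathcal M)\xrightarrow{\ \mathfrak p_x\ }\mathbb A(\mathcal M/x)\to0$$ is exact, and it splits: there are linear maps $r:\mathbb A(\mathcal M)\to\mathbb A(\mathcal M\setminus x)$ and $s:\mathbb A(\mathcal M/x)\to\mathbb A(\mathcal M)$ with $r\,\mathfrak i_x=\mathrm{id}$, $\mathfrak p_x s=\mathrm{id}$ and $\mathfrak i_x r+s\,\mathfrak p_x=\mathrm{id}$. -/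

import Mathlib

open scoped Matroid

noncomputable section

namespace ChiMatroid

variable {α : Type*} [LinearOrder α] {K : Type*} [Field K]

/-- The defining relations of the skew algebra on generators indexed by `S`:
`e_i ^ 2 = 0`, and `e_j * e_i = β i j • (e_i * e_j)` for `i < j`. -/
inductive SkewRel (β : α → α → Kˣ) (S : Set α) : FreeAlgebra K S → FreeAlgebra K S → Prop
  | sq (i : S) : SkewRel β S (FreeAlgebra.ι K i * FreeAlgebra.ι K i) 0
  | comm (i j : S) (h : i < j) :
      SkewRel β S (FreeAlgebra.ι K j * FreeAlgebra.ι K i)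
        ((β i j : K) • (FreeAlgebra.ι K i * FreeAlgebra.ι K j))

/-- The unital associative `K`-algebra generated by `e_i`, `i ∈ S`, with the relations `SkewRel`.
The values `β i j` matter only for `i < j` in `S`. -/
abbrev SkewAlg (β : α → α → Kˣ) (S : Set α) : Type _ := RingQuot (SkewRel β S)

open Classical in
/-- The generator `e_i` for `i ∈ S` (the value `0` for `i ∉ S` is a convention, never used). -/
def gen (β : α → α → Kˣ) (S : Set α) (i : α) : SkewAlg β S :=
  if h : i ∈ S then RingQuot.mkAlgHom K (SkewRel β S) (FreeAlgebra.ι K ⟨i, h⟩) else 0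

/-- The pure element `e_X = e_{i₁} * ⋯ * e_{iₘ}` for `X = {i₁ < ⋯ < iₘ}`; `e_∅ = 1`. -/
def mono (β : α → α → Kˣ) (S : Set α) (X : Finset α) : SkewAlg β S :=
  (X.sort.map (gen β S)).prod

/-- Number of inversions of a finite sequence. -/
def inversions : List α → ℕ
  | [] => 0
  | a :: l => l.countP (fun b => decide (b < a)) + inversions l

/-- The extension of `χ` to ordered sets: `χ(X^σ) = sgn(σ) χ(X)`; here the ordered set is a list
without repetitions and the sign is computed from the number of inversions. -/
def chiOrd (χ : Finset α → K) (l : List α) : K :=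
  (-1) ^ inversions l * χ l.toFinset

/-- The `χ`-boundary of `e_X`: `∂ e_X = ∑ₚ (-1)^p χ(X ∖ iₚ) e_{X ∖ iₚ}` for
`X = {i₁ < ⋯ < iₘ}`, with the convention `∂ e_i = 1` for singletons.
The position `p` of `i` in `X` is the number of elements of `X` that are `≤ i`. -/
def boundary (β : α → α → Kˣ) (χ : Finset α → K) (S : Set α) (X : Finset α) : SkewAlg β S :=
  if X.card = 1 then 1
  else ∑ i ∈ X, ((-1) ^ (X.filter (fun j => j ≤ i)).card * χ (X.erase i)) • mono β S (X.erase i)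

/-- `U` is a unidependent set of `M`: it contains exactly one circuit. -/
def IsUnidep (M : Matroid α) (U : Finset α) : Prop :=
  (U : Set α) ⊆ M.E ∧ ∃! C : Set α, M.IsCircuit C ∧ C ⊆ (U : Set α)

/-- The two conditions on `χ : 2^E → K` in the definition of a `χ`-algebra. -/
structure IsChi (M : Matroid α) (β : α → α → Kˣ) (χ : Finset α → K) : Prop where
  ne_zero_iff : ∀ I : Finset α, (I : Set α) ⊆ M.E → (χ I ≠ 0 ↔ M.Indep (I : Set α))
  boundary_eq : ∀ U U' : Finset α, IsUnidep M U → IsUnidep M U' → U' ⊆ U →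
    ∃ ε : Kˣ, boundary β χ M.E U = (ε : K) • (boundary β χ M.E U' * mono β M.E (U \ U'))

/-- The generators of the `χ`-ideal: the boundaries of the circuits with more than one element,
and the loops. -/
def idealGens (M : Matroid α) (β : α → α → Kˣ) (χ : Finset α → K) : Set (SkewAlg β M.E) :=
  {g | ∃ C : Finset α, M.IsCircuit (C : Set α) ∧ 1 < C.card ∧ g = boundary β χ M.E C} ∪
  {g | ∃ i : α, M.IsLoop i ∧ g = gen β M.E i}

/-- The right ideal generated by `idealGens`, as a `K`-subspace. -/
def chiIdeal (M : Matroid α) (β : α → α → Kˣ) (χ : Finset α → K) : Submodule K (SkewAlg β M.E) :=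
  Submodule.span K {z | ∃ g ∈ idealGens M β χ, ∃ a : SkewAlg β M.E, z = g * a}

/-- The vector space `A_χ(M)`, the quotient of the skew algebra on the ground set of `M` by the
`χ`-ideal. -/
abbrev ChiAlg (M : Matroid α) (β : α → α → Kˣ) (χ : Finset α → K) : Type _ :=
  SkewAlg β M.E ⧸ chiIdeal M β χ

/-- The residue class of `e_X` in `A_χ(M)`. -/
def cls (M : Matroid α) (β : α → α → Kˣ) (χ : Finset α → K) (X : Finset α) : ChiAlg M β χ :=
  (chiIdeal M β χ).mkQ (mono β M.E X)

/-- The map `χ_{M／x}(X) = χ(X ∘ x)` on subsets `X` of `E ∖ x`. -/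
def chiContract (χ : Finset α → K) (x : α) (X : Finset α) : K :=
  chiOrd χ (X.sort ++ [x])

/-- Two distinct elements are parallel if they form a circuit. -/
def AreParallel (M : Matroid α) (x y : α) : Prop := x ≠ y ∧ M.IsCircuit {x, y}

/-- A matroid is simple if it has no loops and no pair of parallel elements. -/
def IsSimple (M : Matroid α) : Prop :=
  (∀ x, ¬ M.IsLoop x) ∧ ∀ x y, ¬ AreParallel M x y

/-- `A(M ∖ x)`; its `χ`-map is the restriction of `χ` to subsets of `E ∖ x`. -/
abbrev DelAlg (M : Matroid α) (β : α → α → Kˣ) (χ : Finset α → K) (x : α) : Type _ :=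
  ChiAlg (M ＼ {x}) β χ

/-- `A(M ／ x)`, with respect to `χ_{M／x}`. -/
abbrev ConAlg (M : Matroid α) (β : α → α → Kˣ) (χ : Finset α → K) (x : α) : Type _ :=
  ChiAlg (M ／ {x}) β (chiContract χ x)

/-- `f` is the inclusion map: `e_I ↦ e_I` for every independent set `I` of `M ∖ x`. -/
def IsInclusion (M : Matroid α) (β : α → α → Kˣ) (χ : Finset α → K) (x : α)
    (f : DelAlg M β χ x →ₗ[K] ChiAlg M β χ) : Prop :=
  ∀ I : Finset α, (M ＼ {x}).Indep (I : Set α) → f (cls (M ＼ {x}) β χ I) = cls M β χ I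

/-- `f` is the residue map: for every independent set `I` of `M`, `e_I` is sent to `e_{I ∖ x}` if
`x ∈ I`; to `(χ(I ∖ y, x) / χ(I ∖ y, y)) e_{I ∖ y}` if some `y ∈ I` is parallel to `x`;
and to `0` otherwise. -/
def IsResidue (M : Matroid α) (β : α → α → Kˣ) (χ : Finset α → K) (x : α)
    (f : ChiAlg M β χ →ₗ[K] ConAlg M β χ x) : Prop :=
  ∀ I : Finset α, M.Indep (I : Set α) →
    (x ∈ I → f (cls M β χ I) = cls (M ／ {x}) β (chiContract χ x) (I.erase x)) ∧
    (∀ y ∈ I, AreParallel M x y → f (cls M β χ I) =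
      (chiOrd χ ((I.erase y).sort ++ [x]) / chiOrd χ ((I.erase y).sort ++ [y])) •
        cls (M ／ {x}) β (chiContract χ x) (I.erase y)) ∧
    (x ∉ I → (∀ y ∈ I, ¬ AreParallel M x y) → f (cls M β χ I) = 0)

end ChiMatroid

end

set_option linter.unusedSectionVars false

noncomputable section

namespace ChiMatroid

variable {α : Type*} [LinearOrder α] {K : Type*} [Field K]

/-! ### Pure elements form a basis of the skew algebra -/

section SkewAlgebra

variable {β : α → α → Kˣ} {S : Set α}

/-! Pure elements are a basis of the skew algebra, and for a loopless matroid condition (2) makes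
the `χ`-ideal the linear span of the `e_X` with `X` dependent and the `∂ e_U` with `U` unidependent
(`chiIdeal_le`). So a linear map out of the `χ`-algebra is a function on sets that kills dependent
sets and satisfies one relation per unidependent set (`exists_chiLift`). Simplicity of `M` makes
`M`, `M ＼ {x}` and `M ／ {x}` all loopless, so this applies to each. The relations of the minors are
those of `M`, for contraction up to the sign in `bdCoef_insert`; this yields admissibility and both
maps.

Exactness in the middle is formal: inserting `x` defines a map from `A(M ／ x)` to `A(M)` modulo the
image of the inclusion, and its composite with the residue is the quotient map.

Injectivity is the substantial point. No-broken-circuit sets span (`span_nbc`), by straightening. An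
independent set `I` gives a flag of flats and a linear form supported on the sets with one element
in each step of the flag (`exists_flagForm`); among no-broken-circuit sets only `I` itself is such a
set (`IsNbc.eq_of_isAdapted`). Giving `x` the greatest weight makes no-broken-circuit sets of `M ＼
{x}` remain so in `M`, so these forms on `A(M)` detect every coefficient. -/

theorem gen_of_mem {i : α} (h : i ∈ S) :
    gen β S i = RingQuot.mkAlgHom K (SkewRel β S) (FreeAlgebra.ι K ⟨i, h⟩) := by
  simp [gen, h]

theorem gen_mul_self (i : α) : gen β S i * gen β S i = 0 := by
  by_cases h : i ∈ S
  · rw [gen_of_mem h, ← map_mul, RingQuot.mkAlgHom_rel K (SkewRel.sq (β := β) ⟨i, h⟩), map_zero]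
  · simp [gen, h]

theorem gen_mul_gen {i j : α} (h : i < j) :
    gen β S j * gen β S i = (β i j : K) • (gen β S i * gen β S j) := by
  by_cases hi : i ∈ S
  · by_cases hj : j ∈ S
    · rw [gen_of_mem hi, gen_of_mem hj, ← map_mul,
        RingQuot.mkAlgHom_rel K (SkewRel.comm (β := β) ⟨i, hi⟩ ⟨j, hj⟩ h), map_smul, map_mul]
    · simp [gen, hj]
  · simp [gen, hi]

@[simp]
theorem mono_empty : mono β S ∅ = 1 := by
  simp [mono]

theorem mono_insert_lt {a : α} {X : Finset α} (h : ∀ b ∈ X, a < b) :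
    mono β S (insert a X) = gen β S a * mono β S X := by
  have ha : a ∉ X := fun ha => lt_irrefl a (h a ha)
  unfold mono
  rw [Finset.sort_insert _ (fun b hb => (h b hb).le) ha, List.map_cons, List.prod_cons]

theorem mono_singleton (a : α) : mono β S {a} = gen β S a := by
  simp [mono]

/-- Multiplying `e_Y` by a generator that already divides it gives zero. -/
theorem gen_mul_mono_of_mem {i : α} {Y : Finset α} (h : i ∈ Y) :
    gen β S i * mono β S Y = 0 := by
  induction Y using Finset.induction_on_min with
  | empty => simp at h
  | insert a Y hlt ih =>
    rw [mono_insert_lt hlt, ← mul_assoc]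
    rcases Finset.mem_insert.1 h with rfl | h
    · rw [gen_mul_self, zero_mul]
    · rw [gen_mul_gen (hlt i h), smul_mul_assoc, mul_assoc, ih h, mul_zero, smul_zero]

/-- The scalar that sorts the product `e_X * e_Y`. -/
def sortCoef (β : α → α → Kˣ) (X Y : Finset α) : Kˣ :=
  ∏ i ∈ X, ∏ j ∈ Y with j < i, β j i

theorem gen_mul_mono {i : α} {Y : Finset α} (h : i ∉ Y) :
    gen β S i * mono β S Y = ((∏ j ∈ Y with j < i, β j i : Kˣ) : K) • mono β S (insert i Y) := by
  induction Y using Finset.induction_on_min with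
  | empty => simp [mono_singleton]
  | insert a Y hlt ih =>
    obtain ⟨hia, hY⟩ : i ≠ a ∧ i ∉ Y := by simpa using h
    have haY : a ∉ Y := fun ha => lt_irrefl a (hlt a ha)
    rcases lt_or_gt_of_ne hia with hlt' | hgt
    · have hall : ∀ b ∈ insert a Y, i < b := by
        intro b hb
        rcases Finset.mem_insert.1 hb with rfl | hb
        · exact hlt'
        · exact hlt'.trans (hlt b hb)
      rw [Finset.filter_false_of_mem (fun b hb => (hall b hb).le.not_gt), mono_insert_lt hall]
      simp
    · have hall : ∀ b ∈ insert i Y, a < b := by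
        intro b hb
        rcases Finset.mem_insert.1 hb with rfl | hb
        · exact hgt
        · exact hlt b hb
      rw [mono_insert_lt hlt, ← mul_assoc, gen_mul_gen hgt, smul_mul_assoc, mul_assoc, ih hY,
        mul_smul_comm, ← mono_insert_lt hall, Finset.insert_comm, Finset.filter_insert, if_pos hgt,
        Finset.prod_insert (by simp [haY]), Units.val_mul, mul_smul]

theorem mono_mul_mono {X Y : Finset α} (h : Disjoint X Y) :
    mono β S X * mono β S Y = (sortCoef β X Y : K) • mono β S (X ∪ Y) := by
  induction X using Finset.induction_on_min with
  | empty => simp [sortCoef]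
  | insert a X hlt ih =>
    have haX : a ∉ X := fun ha => lt_irrefl a (hlt a ha)
    obtain ⟨haY, hXY⟩ := Finset.disjoint_insert_left.1 h
    have hf : (X ∪ Y).filter (fun j => j < a) = Y.filter (fun j => j < a) := by
      rw [Finset.filter_union, Finset.filter_false_of_mem (fun b hb => (hlt b hb).le.not_gt),
        Finset.empty_union]
    rw [mono_insert_lt hlt, mul_assoc, ih hXY, mul_smul_comm, gen_mul_mono (by simp [haX, haY]),
      hf, smul_smul, Finset.insert_union, sortCoef, sortCoef, Finset.prod_insert haX, mul_comm,
      Units.val_mul]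

theorem mono_mul_mono_of_not_disjoint {X Y : Finset α} (h : ¬ Disjoint X Y) :
    mono β S X * mono β S Y = 0 := by
  induction X using Finset.induction_on_min with
  | empty => simp at h
  | insert a X hlt ih =>
    rw [mono_insert_lt hlt, mul_assoc]
    by_cases hXY : Disjoint X Y
    · have haY : a ∈ Y := by
        by_contra haY
        exact h (Finset.disjoint_insert_left.2 ⟨haY, hXY⟩)
      rw [mono_mul_mono hXY, mul_smul_comm, gen_mul_mono_of_mem (by simp [haY]), smul_zero]
    · rw [ih hXY, mul_zero]

theorem sortCoef_insert {x : α} {X Y : Finset α} (h : x ∉ X) :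
    sortCoef β (insert x X) Y = sortCoef β {x} Y * sortCoef β X Y := by
  simp [sortCoef, Finset.prod_insert h]

/-- The pure elements span the skew algebra. -/
theorem span_mono : Submodule.span K {z | ∃ X : Finset α, (X : Set α) ⊆ S ∧ z = mono β S X} = ⊤ := by
  set V := Submodule.span K {z | ∃ X : Finset α, (X : Set α) ⊆ S ∧ z = mono β S X} with hV
  have key : ∀ a : FreeAlgebra K S, ∀ z ∈ V, RingQuot.mkAlgHom K (SkewRel β S) a * z ∈ V := by
    intro a
    induction a using FreeAlgebra.induction with
    | grade0 r =>
      intro z hz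
      rw [AlgHom.commutes, ← Algebra.smul_def]
      exact V.smul_mem r hz
    | grade1 i =>
      intro z hz
      rw [← gen_of_mem i.2]
      induction hz using Submodule.span_induction with
      | mem z hz =>
        obtain ⟨X, hX, rfl⟩ := hz
        by_cases hi : (i : α) ∈ X
        · rw [gen_mul_mono_of_mem hi]
          exact V.zero_mem
        · rw [gen_mul_mono hi]
          refine V.smul_mem _ (Submodule.subset_span ⟨_, ?_, rfl⟩)
          rw [Finset.coe_insert]
          exact Set.insert_subset i.2 hX
      | zero => simp
      | add y z _ _ hy hz => rw [mul_add]; exact V.add_mem hy hz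
      | smul c z _ hz => rw [mul_smul_comm]; exact V.smul_mem c hz
    | mul a b ha hb =>
      intro z hz
      rw [map_mul, mul_assoc]
      exact ha _ (hb _ hz)
    | add a b ha hb =>
      intro z hz
      rw [map_add, add_mul]
      exact V.add_mem (ha _ hz) (hb _ hz)
  rw [eq_top_iff]
  intro z _
  obtain ⟨a, rfl⟩ := RingQuot.mkAlgHom_surjective K (SkewRel β S) z
  have h1 : (1 : SkewAlg β S) ∈ V := Submodule.subset_span ⟨∅, by simp, by simp⟩
  simpa using key a 1 h1

/-- Left multiplication by `e_j` on the vector space with basis the finite sets. -/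
def leftMul (β : α → α → Kˣ) (j : α) : (Finset α →₀ K) →ₗ[K] (Finset α →₀ K) :=
  Finsupp.linearCombination K fun X : Finset α =>
    if j ∈ X then 0 else
      Finsupp.single (insert j X) ((∏ i ∈ X with i < j, β i j : Kˣ) : K)

theorem leftMul_single_of_mem {j : α} {X : Finset α} (h : j ∈ X) (c : K) :
    leftMul β j (Finsupp.single X c) = 0 := by
  simp [leftMul, h]

theorem leftMul_single {j : α} {X : Finset α} (h : j ∉ X) (c : K) :
    leftMul β j (Finsupp.single X c) =
      Finsupp.single (insert j X) (c * ((∏ i ∈ X with i < j, β i j : Kˣ) : K)) := by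
  simp [leftMul, h]

theorem leftMul_leftMul_self (j : α) : leftMul β j * leftMul β j = 0 := by
  refine Finsupp.lhom_ext fun X c => ?_
  rw [Module.End.mul_apply]
  by_cases h : j ∈ X
  · simp [leftMul_single_of_mem h]
  · rw [leftMul_single h, leftMul_single_of_mem (by simp)]
    simp

theorem leftMul_leftMul {i j : α} (hij : i < j) :
    leftMul β j * leftMul β i = (β i j : K) • (leftMul β i * leftMul β j) := by
  refine Finsupp.lhom_ext fun X c => ?_
  rw [LinearMap.smul_apply, Module.End.mul_apply, Module.End.mul_apply]
  by_cases hi : i ∈ X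
  · rw [leftMul_single_of_mem hi]
    by_cases hj : j ∈ X
    · simp [leftMul_single_of_mem hj]
    · rw [leftMul_single hj, leftMul_single_of_mem (by simp [hi])]
      simp
  · rw [leftMul_single hi]
    by_cases hj : j ∈ X
    · rw [leftMul_single_of_mem hj, leftMul_single_of_mem (by simp [hj])]
      simp
    · rw [leftMul_single hj, leftMul_single (by simp [hj, hij.ne']),
        leftMul_single (by simp [hi, hij.ne]), Finset.insert_comm, Finset.filter_insert,
        if_pos hij, Finset.filter_insert, if_neg hij.le.not_gt,
        Finset.prod_insert (by simp [hi]), Finsupp.smul_single, smul_eq_mul]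
      congr 1
      push_cast
      ring

/-- The left regular representation of the skew algebra, on the basis of pure elements. -/
def leftRep (β : α → α → Kˣ) (S : Set α) : SkewAlg β S →ₐ[K] Module.End K (Finset α →₀ K) :=
  RingQuot.liftAlgHom K ⟨FreeAlgebra.lift K fun i : S => leftMul (K := K) β (i : α), by
    intro a b h
    cases h with
    | sq i => simpa using leftMul_leftMul_self (β := β) (i : α)
    | comm i j h => simpa using leftMul_leftMul (β := β) h⟩

theorem leftRep_gen {i : α} (h : i ∈ S) : leftRep β S (gen β S i) = leftMul β i := by
  rw [gen_of_mem h, leftRep, RingQuot.liftAlgHom_mkAlgHom_apply]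
  simp

/-- Acting on the basis vector of `∅` sends pure elements to distinct basis vectors; hence they are
linearly independent and `monoLift` takes its prescribed values. -/
theorem leftRep_mono {X : Finset α} (hX : (X : Set α) ⊆ S) :
    leftRep β S (mono β S X) (Finsupp.single ∅ 1) = Finsupp.single X 1 := by
  induction X using Finset.induction_on_min with
  | empty => simp
  | insert a X hlt ih =>
    have haX : a ∉ X := fun ha => lt_irrefl a (hlt a ha)
    rw [Finset.coe_insert, Set.insert_subset_iff] at hX
    rw [mono_insert_lt hlt, map_mul, Module.End.mul_apply, ih hX.2, leftRep_gen hX.1,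
      leftMul_single haX, Finset.filter_false_of_mem (fun b hb => (hlt b hb).le.not_gt)]
    simp

variable {V : Type*} [AddCommGroup V] [Module K V]

/-- The linear map on the skew algebra with prescribed values on the pure elements. -/
def monoLift (β : α → α → Kˣ) (S : Set α) (f : Finset α → V) : SkewAlg β S →ₗ[K] V :=
  Finsupp.linearCombination K f ∘ₗ LinearMap.applyₗ (Finsupp.single ∅ 1) ∘ₗ
    (leftRep β S).toLinearMap

theorem monoLift_mono (f : Finset α → V) {X : Finset α} (hX : (X : Set α) ⊆ S) :
    monoLift β S f (mono β S X) = f X := by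
  simp [monoLift, leftRep_mono hX]

theorem monoLift_boundary (χ : Finset α → K) (f : Finset α → V) {X : Finset α}
    (hX : (X : Set α) ⊆ S) (hc : X.card ≠ 1) :
    monoLift β S f (boundary β χ S X) =
      ∑ i ∈ X, ((-1) ^ (X.filter (fun j => j ≤ i)).card * χ (X.erase i)) • f (X.erase i) := by
  rw [boundary, if_neg hc, map_sum]
  refine Finset.sum_congr rfl fun i _ => ?_
  rw [map_smul, monoLift_mono]
  exact (Finset.coe_subset.2 (Finset.erase_subset i X)).trans hX

end SkewAlgebra

/-! ### Linear maps out of a `χ`-algebra -/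

section ChiLift

variable {N : Matroid α} {β : α → α → Kˣ} {χ : Finset α → K}

/-- Deleting an element of the only circuit leaves an independent set; conversely, every circuit
inside an independent set plus `i` is the fundamental circuit of `i`. -/
theorem isUnidep_iff {U : Finset α} :
    IsUnidep N U ↔ N.Dep (U : Set α) ∧ ∃ i ∈ U, N.Indep (U.erase i : Set α) := by
  constructor
  · rintro ⟨hU, C, ⟨hC, hCU⟩, huniq⟩
    refine ⟨hC.dep.superset hCU, ?_⟩
    obtain ⟨i, hi⟩ := hC.nonempty
    refine ⟨i, hCU hi, ?_⟩
    by_contra hd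
    have hdep : N.Dep (U.erase i : Set α) := by
      refine (N.not_indep_iff ?_).1 hd
      exact (Finset.coe_subset.2 (Finset.erase_subset i U)).trans hU
    obtain ⟨C', hC'U, hC'⟩ := hdep.exists_isCircuit_subset
    have : C' = C := huniq C' ⟨hC', hC'U.trans (Finset.coe_subset.2 (Finset.erase_subset i U))⟩
    subst this
    simpa using hC'U hi
  · rintro ⟨hd, i, hi, hI⟩
    refine ⟨hd.subset_ground, ?_⟩
    obtain ⟨C, hCU, hC⟩ := hd.exists_isCircuit_subset
    have hins : (U : Set α) = insert i (U.erase i : Set α) := by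
      rw [← Finset.coe_insert, Finset.insert_erase hi]
    refine ⟨C, ⟨hC, hCU⟩, ?_⟩
    rintro C' ⟨hC', hC'U⟩
    rw [hC.eq_fundCircuit_of_subset hI (hCU.trans hins.subset),
      hC'.eq_fundCircuit_of_subset hI (hC'U.trans hins.subset)]

theorem IsUnidep.subset_ground {U : Finset α} (hU : IsUnidep N U) : (U : Set α) ⊆ N.E := hU.1

theorem IsUnidep.dep {U : Finset α} (hU : IsUnidep N U) : N.Dep (U : Set α) :=
  (isUnidep_iff.1 hU).1

theorem isUnidep_of_isCircuit {C : Finset α} (hC : N.IsCircuit (C : Set α)) : IsUnidep N C := by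
  obtain ⟨i, hi⟩ := hC.nonempty
  refine isUnidep_iff.2 ⟨hC.dep, i, hi, ?_⟩
  rw [Finset.coe_erase]
  exact hC.sdiff_singleton_indep hi

/-- Without loops, the singleton convention in `boundary` never intervenes. -/
theorem one_lt_card_of_dep [N.Loopless] {X : Finset α} (hX : N.Dep (X : Set α)) :
    1 < X.card := by
  by_contra! hc
  obtain ⟨i, hi⟩ := hX.nonempty
  have hXi : X = {i} := Finset.eq_singleton_iff_unique_mem.2
    ⟨hi, fun j hj => Finset.card_le_one.1 hc j hj i hi⟩
  rw [hXi, Finset.coe_singleton, Matroid.singleton_dep] at hX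
  exact N.not_isLoop i hX

/-- The coefficient of `e_{U ∖ i}` in the `χ`-boundary of `e_U`. -/
def bdCoef (χ : Finset α → K) (U : Finset α) (i : α) : K :=
  (-1) ^ (U.filter (fun j => j ≤ i)).card * χ (U.erase i)

theorem boundary_eq_sum {S : Set α} {U : Finset α} (h : 1 < U.card) :
    boundary β χ S U = ∑ i ∈ U, bdCoef χ U i • mono β S (U.erase i) := by
  rw [boundary, if_neg h.ne']
  rfl

theorem mul_mem_chiIdeal {z : SkewAlg β N.E} (hz : z ∈ chiIdeal N β χ) (a : SkewAlg β N.E) :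
    z * a ∈ chiIdeal N β χ := by
  unfold chiIdeal at hz
  induction hz using Submodule.span_induction with
  | mem z hz =>
    obtain ⟨g, hg, b, rfl⟩ := hz
    exact Submodule.subset_span ⟨g, hg, b * a, mul_assoc g b a⟩
  | zero => simp
  | add y z _ _ hy hz => rw [add_mul]; exact Submodule.add_mem _ hy hz
  | smul c z _ hz => rw [smul_mul_assoc]; exact Submodule.smul_mem _ c hz

theorem boundary_mem_chiIdeal_of_isCircuit [N.Loopless] {C : Finset α}
    (hC : N.IsCircuit (C : Set α)) : boundary β χ N.E C ∈ chiIdeal N β χ :=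
  Submodule.subset_span
    ⟨_, Or.inl ⟨C, hC, one_lt_card_of_dep hC.dep, rfl⟩, 1, (mul_one _).symm⟩

/-- For a circuit `C ⊆ X` and `i ∈ C`, multiply `∂ e_C` by `e_Y` with `Y = X ∖ (C ∖ i)`. Since `i ∈
Y`, every term but the one omitting `i` repeats `e_i` and vanishes; the survivor is a nonzero
multiple of `e_X`. -/
theorem mono_mem_chiIdeal [N.Loopless] (hχ : IsChi N β χ) {X : Finset α}
    (hX : N.Dep (X : Set α)) : mono β N.E X ∈ chiIdeal N β χ := by
  obtain ⟨C, hCX, hC⟩ := hX.exists_isCircuit_subset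
  lift C to Finset α using X.finite_toSet.subset hCX
  obtain ⟨i, hi⟩ := hC.nonempty
  rw [Finset.coe_subset] at hCX
  rw [Finset.mem_coe] at hi
  have hmem := mul_mem_chiIdeal (boundary_mem_chiIdeal_of_isCircuit (β := β) (χ := χ) hC)
    (mono β N.E (X \ C.erase i))
  rw [boundary_eq_sum (one_lt_card_of_dep hC.dep), Finset.sum_mul,
    Finset.sum_eq_single_of_mem i hi, smul_mul_assoc, mono_mul_mono Finset.disjoint_sdiff,
    Finset.union_sdiff_of_subset ((Finset.erase_subset i C).trans hCX), smul_smul] at hmem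
  · refine (Submodule.smul_mem_iff _ (mul_ne_zero (mul_ne_zero ?_ ?_) (Units.ne_zero _))).1 hmem
    · exact pow_ne_zero _ (neg_ne_zero.2 one_ne_zero)
    · refine (hχ.ne_zero_iff _ ?_).2 ?_
      · exact (Finset.coe_subset.2 ((Finset.erase_subset i C).trans hCX)).trans hX.subset_ground
      · rw [Finset.coe_erase]
        exact hC.sdiff_singleton_indep hi
  · intro k _ hki
    rw [smul_mul_assoc, mono_mul_mono_of_not_disjoint, smul_zero]
    rw [Finset.not_disjoint_iff]
    exact ⟨i, by simp [hi, hki.symm], by simp [hCX hi]⟩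

theorem boundary_mem_chiIdeal [N.Loopless] (hχ : IsChi N β χ) {U : Finset α}
    (hU : IsUnidep N U) : boundary β χ N.E U ∈ chiIdeal N β χ := by
  obtain ⟨C, hCU, hC⟩ := hU.dep.exists_isCircuit_subset
  lift C to Finset α using U.finite_toSet.subset hCU
  rw [Finset.coe_subset] at hCU
  obtain ⟨ε, hε⟩ := hχ.boundary_eq U C hU (isUnidep_of_isCircuit hC) hCU
  rw [hε]
  exact Submodule.smul_mem _ _ (mul_mem_chiIdeal (boundary_mem_chiIdeal_of_isCircuit hC) _)

/-- As a vector space, the `χ`-ideal of a loopless matroid is spanned by the pure elements of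
dependent sets and the boundaries of unidependent sets. -/
theorem chiIdeal_le [N.Loopless] (hχ : IsChi N β χ) {W : Submodule K (SkewAlg β N.E)}
    (hdep : ∀ X : Finset α, N.Dep (X : Set α) → mono β N.E X ∈ W)
    (huni : ∀ U : Finset α, IsUnidep N U → boundary β χ N.E U ∈ W) : chiIdeal N β χ ≤ W := by
  have key : ∀ C : Finset α, N.IsCircuit (C : Set α) → ∀ Y : Finset α, (Y : Set α) ⊆ N.E →
      boundary β χ N.E C * mono β N.E Y ∈ W := by
    intro C hC Y hY
    -- In the first case condition (2) identifies the product with a multiple of `∂ e_{C ∪ Y}`.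
    -- Otherwise every term of the product is zero or a multiple of a dependent pure element.
    by_cases hCY : Disjoint C Y ∧ IsUnidep N (C ∪ Y)
    · obtain ⟨ε, hε⟩ := hχ.boundary_eq (C ∪ Y) C hCY.2 (isUnidep_of_isCircuit hC)
        Finset.subset_union_left
      rw [Finset.union_sdiff_cancel_left hCY.1] at hε
      exact (Submodule.smul_mem_iff _ ε.ne_zero).1 (hε ▸ huni _ hCY.2)
    · rw [boundary_eq_sum (one_lt_card_of_dep hC.dep), Finset.sum_mul]
      refine Submodule.sum_mem _ fun k hk => ?_
      rw [smul_mul_assoc]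
      refine Submodule.smul_mem _ _ ?_
      by_cases hdisj : Disjoint (C.erase k) Y
      · rw [mono_mul_mono hdisj]
        refine Submodule.smul_mem _ _ (hdep _ ?_)
        have hE : ((C ∪ Y : Finset α) : Set α) ⊆ N.E := by
          rw [Finset.coe_union]
          exact Set.union_subset hC.subset_ground hY
        have hsub : C.erase k ∪ Y ⊆ C ∪ Y :=
          Finset.union_subset_union_left (Finset.erase_subset k C)
        rw [← N.not_indep_iff ((Finset.coe_subset.2 hsub).trans hE)]
        intro hI
        by_cases hkY : k ∈ Y
        · refine hC.dep.not_indep (hI.subset (Finset.coe_subset.2 fun j hj => ?_))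
          by_cases hjk : j = k
          · exact Finset.mem_union_right _ (hjk ▸ hkY)
          · exact Finset.mem_union_left _ (Finset.mem_erase.2 ⟨hjk, hj⟩)
        · refine hCY ⟨?_, isUnidep_iff.2 ⟨hC.dep.superset ?_ hE, k, ?_, ?_⟩⟩
          · rw [← Finset.insert_erase hk]
            exact Finset.disjoint_insert_left.2 ⟨hkY, hdisj⟩
          · exact Finset.coe_subset.2 Finset.subset_union_left
          · exact Finset.mem_union_left _ hk
          · rwa [Finset.erase_union_distrib, Finset.erase_eq_of_notMem hkY]
      · rw [mono_mul_mono_of_not_disjoint hdisj]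
        exact W.zero_mem
  refine Submodule.span_le.2 ?_
  rintro _ ⟨g, ⟨C, hC, -, rfl⟩ | ⟨i, hi, -⟩, a, rfl⟩
  · have ha : a ∈ Submodule.span K {z | ∃ X : Finset α, (X : Set α) ⊆ N.E ∧ z = mono β N.E X} := by
      rw [span_mono]
      trivial
    rw [SetLike.mem_coe]
    induction ha using Submodule.span_induction with
    | mem z hz =>
      obtain ⟨Y, hY, rfl⟩ := hz
      exact key C hC Y hY
    | zero => simp
    | add y z _ _ hy hz => rw [mul_add]; exact W.add_mem hy hz
    | smul c z _ hz => rw [mul_smul_comm]; exact W.smul_mem c hz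
  · exact absurd hi (N.not_isLoop i)

theorem cls_eq_zero [N.Loopless] (hχ : IsChi N β χ) {X : Finset α} (hX : N.Dep (X : Set α)) :
    cls N β χ X = 0 :=
  (Submodule.Quotient.mk_eq_zero _).2 (mono_mem_chiIdeal hχ hX)

theorem sum_cls_eq_zero [N.Loopless] (hχ : IsChi N β χ) {U : Finset α} (hU : IsUnidep N U) :
    ∑ i ∈ U, bdCoef χ U i • cls N β χ (U.erase i) = 0 := by
  have h : (chiIdeal N β χ).mkQ (boundary β χ N.E U) = 0 :=
    (Submodule.Quotient.mk_eq_zero _).2 (boundary_mem_chiIdeal hχ hU)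
  rw [boundary_eq_sum (one_lt_card_of_dep hU.dep), map_sum] at h
  simp only [map_smul] at h
  exact h

variable {V : Type*} [AddCommGroup V] [Module K V]

/-- Linear maps on the `χ`-algebra are given by functions of sets that vanish on dependent sets
and on the boundaries of unidependent sets. -/
theorem exists_chiLift [N.Loopless] (hχ : IsChi N β χ) (f : Finset α → V)
    (hdep : ∀ X : Finset α, N.Dep (X : Set α) → f X = 0)
    (huni : ∀ U : Finset α, IsUnidep N U → ∑ i ∈ U, bdCoef χ U i • f (U.erase i) = 0) :
    ∃ g : ChiAlg N β χ →ₗ[K] V, ∀ X : Finset α, (X : Set α) ⊆ N.E → g (cls N β χ X) = f X := by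
  refine ⟨(chiIdeal N β χ).liftQ (monoLift β N.E f) (chiIdeal_le hχ ?_ ?_), ?_⟩
  · intro X hX
    rw [LinearMap.mem_ker, monoLift_mono f hX.subset_ground, hdep X hX]
  · intro U hU
    rw [LinearMap.mem_ker, monoLift_boundary χ f hU.subset_ground
      (one_lt_card_of_dep hU.dep).ne']
    exact huni U hU
  · intro X hX
    rw [cls, Submodule.mkQ_apply, Submodule.liftQ_apply, monoLift_mono f hX]

theorem span_cls [N.Loopless] (hχ : IsChi N β χ) :
    Submodule.span K {z | ∃ I : Finset α, N.Indep (I : Set α) ∧ z = cls N β χ I} = ⊤ := by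
  have h := congrArg (Submodule.map (chiIdeal N β χ).mkQ) (span_mono (β := β) (S := N.E))
  rw [Submodule.map_top, Submodule.range_mkQ, Submodule.map_span] at h
  rw [eq_top_iff, ← h, Submodule.span_le]
  rintro _ ⟨_, ⟨X, hX, rfl⟩, rfl⟩
  by_cases hI : N.Indep (X : Set α)
  · exact Submodule.subset_span ⟨X, hI, rfl⟩
  · have h0 : (chiIdeal N β χ).mkQ (mono β N.E X) = 0 :=
      cls_eq_zero hχ ((N.not_indep_iff hX).1 hI)
    rw [h0]
    exact Submodule.zero_mem _

theorem chiAlg_hom_ext [N.Loopless] (hχ : IsChi N β χ) {f g : ChiAlg N β χ →ₗ[K] V}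
    (h : ∀ I : Finset α, N.Indep (I : Set α) → f (cls N β χ I) = g (cls N β χ I)) : f = g := by
  refine LinearMap.ext_on (span_cls hχ) ?_
  rintro _ ⟨I, hI, rfl⟩
  exact h I hI

end ChiLift

/-! ### Admissibility for deletion and contraction -/

section Minors

variable {M : Matroid α} {β : α → α → Kˣ} {χ : Finset α → K} {x : α}

theorem IsSimple.loopless (hM : IsSimple M) : M.Loopless :=
  Matroid.loopless_iff_forall_not_isLoop.2 fun e _ => hM.1 e

theorem loopless_delete [M.Loopless] : (M ＼ {x}).Loopless := by
  refine Matroid.loopless_iff_forall_not_isLoop.2 fun e _ he => ?_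
  rw [← Matroid.singleton_dep, Matroid.delete_dep_iff, Matroid.singleton_dep] at he
  exact M.not_isLoop e he.1

theorem indep_singleton [M.Loopless] (hx : x ∈ M.E) : M.Indep {x} :=
  (M.isNonloop_of_loopless hx).indep

theorem indep_contract_iff [M.Loopless] (hx : x ∈ M.E) {I : Finset α} :
    (M ／ {x}).Indep (I : Set α) ↔ x ∉ I ∧ M.Indep (insert x I : Finset α) := by
  rw [(indep_singleton hx).contract_indep_iff, Set.disjoint_singleton_right, Finset.mem_coe,
    Set.union_singleton, Finset.coe_insert]

theorem dep_contract_iff [M.Loopless] (hx : x ∈ M.E) {I : Finset α} :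
    (M ／ {x}).Dep (I : Set α) ↔ x ∉ I ∧ M.Dep (insert x I : Finset α) := by
  rw [(indep_singleton hx).contract_dep_iff, Set.disjoint_singleton_right, Finset.mem_coe,
    Set.union_singleton, Finset.coe_insert]

/-- A loop `y` of the contraction makes `{x, y}` dependent; a circuit inside has at least two
elements, so `x` and `y` would be parallel. -/
theorem IsSimple.loopless_contract (hM : IsSimple M) (hx : x ∈ M.E) : (M ／ {x}).Loopless := by
  have := hM.loopless
  refine Matroid.loopless_iff_forall_not_isLoop.2 fun y _ hy => ?_
  rw [← Matroid.singleton_dep, ← Finset.coe_singleton y, dep_contract_iff hx] at hy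
  obtain ⟨hxy, hd⟩ := hy
  obtain ⟨C, hCX, hC⟩ := hd.exists_isCircuit_subset
  lift C to Finset α using Finset.finite_toSet _ |>.subset hCX
  rw [Finset.coe_subset] at hCX
  have hcard : (insert x {y} : Finset α).card ≤ C.card :=
    Finset.card_le_two.trans (one_lt_card_of_dep hC.dep)
  have hCeq := Finset.eq_of_subset_of_card_le hCX hcard
  refine hM.2 x y ⟨fun h => hxy (by simp [h]), ?_⟩
  rw [hCeq] at hC
  simpa using hC

theorem isUnidep_delete_iff {U : Finset α} :
    IsUnidep (M ＼ {x}) U ↔ x ∉ U ∧ IsUnidep M U := by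
  simp only [isUnidep_iff, Matroid.delete_dep_iff, Matroid.delete_indep_iff,
    Set.disjoint_singleton_right, Finset.mem_coe, Finset.mem_erase]
  constructor
  · rintro ⟨⟨hd, hx⟩, i, hi, hI, -⟩
    exact ⟨hx, hd, i, hi, hI⟩
  · rintro ⟨hx, hd, i, hi, hI⟩
    exact ⟨⟨hd, hx⟩, i, hi, hI, fun h => hx h.2⟩

theorem isUnidep_contract_iff [M.Loopless] (hx : x ∈ M.E) {U : Finset α} :
    IsUnidep (M ／ {x}) U ↔ x ∉ U ∧ IsUnidep M (insert x U) := by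
  rw [isUnidep_iff, dep_contract_iff hx, and_assoc]
  refine and_congr_right fun hxU => ?_
  constructor
  · rintro ⟨hd, i, hi, hI⟩
    rw [indep_contract_iff hx] at hI
    refine isUnidep_iff.2 ⟨hd, i, Finset.mem_insert_of_mem hi, ?_⟩
    have hxi : x ≠ i := fun h => hxU (h ▸ hi)
    rw [Finset.erase_insert_of_ne hxi]
    exact hI.2
  · intro h
    refine ⟨h.dep, ?_⟩
    obtain ⟨C, hCU, hC⟩ := h.dep.exists_isCircuit_subset
    lift C to Finset α using Finset.finite_toSet _ |>.subset hCU
    -- The unique circuit is not `{x}`, so it can be broken at an element that survives in the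
    -- contraction.
    obtain ⟨i, hiC, hix⟩ := Finset.exists_mem_ne (one_lt_card_of_dep hC.dep) x
    have hi : i ∈ U := Finset.mem_of_mem_insert_of_ne (hCU hiC) hix
    refine ⟨i, hi, (indep_contract_iff hx).2 ⟨fun h => hxU (Finset.mem_of_mem_erase h), ?_⟩⟩
    rw [← Finset.erase_insert_of_ne hix.symm]
    by_contra hnI
    rw [M.not_indep_iff ((Finset.coe_subset.2 (Finset.erase_subset _ _)).trans
      h.subset_ground)] at hnI
    obtain ⟨C', hC'U, hC'⟩ := hnI.exists_isCircuit_subset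
    have : C' = (C : Set α) := h.2.unique
      ⟨hC', hC'U.trans (Finset.coe_subset.2 (Finset.erase_subset _ _))⟩ ⟨hC, hCU⟩
    rw [this] at hC'U
    simpa using hC'U hiC

theorem boundary_mul_mono {S : Set α} {U U' : Finset α} (hc : 1 < U'.card) (h : U' ⊆ U) :
    boundary β χ S U' * mono β S (U \ U') =
      ∑ i ∈ U', (bdCoef χ U' i * (sortCoef β (U'.erase i) (U \ U') : K)) •
        mono β S (U.erase i) := by
  rw [boundary_eq_sum hc, Finset.sum_mul]
  refine Finset.sum_congr rfl fun i hi => ?_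
  rw [smul_mul_assoc, mono_mul_mono (Finset.disjoint_sdiff.mono_left (Finset.erase_subset _ _)),
    smul_smul]
  congr 2
  ext j
  simp only [Finset.mem_union, Finset.mem_erase, Finset.mem_sdiff]
  have := @h j
  by_cases hj : j = i
  · subst hj
    tauto
  · tauto

/-- The second condition on `χ`, compared coefficientwise. -/
theorem IsChi.exists_sum_eq [M.Loopless] (hχ : IsChi M β χ) {U U' : Finset α}
    (hU : IsUnidep M U) (hU' : IsUnidep M U') (h : U' ⊆ U) {V : Type*} [AddCommGroup V]
    [Module K V] (f : Finset α → V) :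
    ∃ ε : Kˣ, ∑ i ∈ U, bdCoef χ U i • f (U.erase i) = (ε : K) •
      ∑ i ∈ U', (bdCoef χ U' i * (sortCoef β (U'.erase i) (U \ U') : K)) • f (U.erase i) := by
  obtain ⟨ε, hε⟩ := hχ.boundary_eq U U' hU hU' h
  refine ⟨ε, ?_⟩
  have hsub : ∀ i, ((U.erase i : Finset α) : Set α) ⊆ M.E := fun i =>
    (Finset.coe_subset.2 (Finset.erase_subset i U)).trans hU.subset_ground
  rw [boundary_mul_mono (one_lt_card_of_dep hU'.dep) h,
    boundary_eq_sum (one_lt_card_of_dep hU.dep)] at hε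
  simpa only [map_smul, map_sum, monoLift_mono f (hsub _)] using
    congrArg (monoLift β M.E f) hε

/-- Compared coefficientwise, condition (2) no longer sees the ambient algebra, so it transfers to
the pure elements of the smaller one. -/
theorem IsChi.delete [M.Loopless] (hχ : IsChi M β χ) (x : α) : IsChi (M ＼ {x}) β χ where
  ne_zero_iff I hI := by
    rw [Matroid.delete_ground, Set.subset_sdiff] at hI
    rw [hχ.ne_zero_iff I hI.1, Matroid.delete_indep_iff, and_iff_left hI.2]
  boundary_eq U U' hU hU' h := by
    have := loopless_delete (M := M) (x := x)
    obtain ⟨ε, hε⟩ := hχ.exists_sum_eq (isUnidep_delete_iff.1 hU).2 (isUnidep_delete_iff.1 hU').2 h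
      (mono β (M ＼ {x}).E)
    refine ⟨ε, ?_⟩
    rw [boundary_mul_mono (one_lt_card_of_dep hU'.dep) h,
      boundary_eq_sum (one_lt_card_of_dep hU.dep), hε]

theorem inversions_append_singleton {l : List α} (hl : l.Pairwise (· ≤ ·)) (x : α) :
    inversions (l ++ [x]) = l.countP fun b => decide (x < b) := by
  induction l with
  | nil => rfl
  | cons a l ih =>
    rw [List.pairwise_cons] at hl
    have h0 : l.countP (fun b => decide (b < a)) = 0 :=
      List.countP_eq_zero.2 fun b hb => by simpa using hl.1 b hb
    rw [List.cons_append, inversions, ih hl.2, List.countP_append, h0, List.countP_cons,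
      List.countP_cons, List.countP_nil, zero_add, zero_add, add_comm]

/-- The sign of the ordered set `X ∘ x`. -/
def appendSign (K : Type*) [Field K] (x : α) (X : Finset α) : K :=
  (-1) ^ (X.filter fun j => x < j).card

theorem appendSign_mul_self (x : α) (X : Finset α) :
    appendSign K x X * appendSign K x X = 1 := by
  rw [appendSign, ← mul_pow]
  simp

theorem appendSign_ne_zero (x : α) (X : Finset α) : appendSign K x X ≠ 0 :=
  pow_ne_zero _ (neg_ne_zero.2 one_ne_zero)

theorem chiContract_eq (χ : Finset α → K) (x : α) (X : Finset α) :
    chiContract χ x X = appendSign K x X * χ (insert x X) := by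
  rw [chiContract, chiOrd, inversions_append_singleton (Finset.pairwise_sort X _), appendSign]
  congr 2
  · rw [← Multiset.coe_countP, Finset.sort_eq, Multiset.countP_eq_card_filter, Finset.card_def,
      Finset.filter_val]
  · rw [List.toFinset_append, Finset.sort_toFinset]
    simp

/-- If `i < x`, inserting `x` leaves the position of `i` unchanged, and removing `i` leaves the
append sign unchanged. If `x < i`, the position rises by one and the number of elements above `x`
drops by one. Either way the discrepancy is a sign independent of `i`. -/
theorem bdCoef_insert (χ : Finset α → K) {U : Finset α} (hx : x ∉ U) {i : α} (hi : i ∈ U) :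
    bdCoef χ (insert x U) i = appendSign K x U * bdCoef (chiContract χ x) U i := by
  have hix : i ≠ x := fun h => hx (h ▸ hi)
  have hsq : ∀ n : ℕ, ((-1 : K) ^ n) * (-1) ^ n = 1 := fun n => by
    rw [← mul_pow, neg_one_mul, neg_neg, one_pow]
  rw [bdCoef, bdCoef, chiContract_eq, Finset.erase_insert_of_ne hix.symm, appendSign, appendSign,
    Finset.filter_insert]
  rcases lt_or_gt_of_ne hix with h | h
  · have h0 : (U.erase i).filter (fun j => x < j) = U.filter fun j => x < j := by
      rw [Finset.filter_erase, Finset.erase_eq_of_notMem (by simp [h.le])]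
    rw [if_neg h.not_ge, h0]
    linear_combination (-(-1) ^ (U.filter fun j => j ≤ i).card * χ (insert x (U.erase i))) *
      hsq (U.filter fun j => x < j).card
  · have hmem : i ∈ U.filter fun j => x < j := by simp [hi, h]
    rw [if_pos h.le, Finset.card_insert_of_notMem (by simp [hx]), Finset.filter_erase,
      ← Finset.card_erase_add_one hmem, pow_succ, pow_succ]
    linear_combination ((-1) ^ (U.filter fun j => j ≤ i).card * χ (insert x (U.erase i))) *
      hsq ((U.filter fun j => x < j).erase i).card

theorem IsChi.contract [M.Loopless] [(M ／ {x}).Loopless] (hχ : IsChi M β χ) (hx : x ∈ M.E) :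
    IsChi (M ／ {x}) β (chiContract χ x) where
  ne_zero_iff I hI := by
    rw [Matroid.contract_ground, Set.subset_sdiff, Set.disjoint_singleton_right] at hI
    rw [chiContract_eq, mul_ne_zero_iff, and_iff_right (appendSign_ne_zero x I),
      hχ.ne_zero_iff, indep_contract_iff hx, and_iff_right (by simpa using hI.2)]
    rw [Finset.coe_insert]
    exact Set.insert_subset hx hI.1
  boundary_eq U U' hU hU' h := by
    obtain ⟨hxU, hxUu⟩ := (isUnidep_contract_iff hx).1 hU
    obtain ⟨hxU', hxUu'⟩ := (isUnidep_contract_iff hx).1 hU'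
    -- The test function strips `x` and kills sets without it. Only the term omitting `x` is lost,
    -- on both sides.
    obtain ⟨ε, hε⟩ := hχ.exists_sum_eq hxUu hxUu' (Finset.insert_subset_insert x h)
      (fun X => if x ∈ X then mono β (M ／ {x}).E (X.erase x) else 0)
    have hne : ∀ {W : Finset α}, x ∉ W → ∀ i ∈ W, x ≠ i := fun hW i hi hxi => hW (hxi ▸ hi)
    have herase : ∀ i, i ≠ x → ((insert x U).erase i).erase x = U.erase i := fun i hi => by
      rw [Finset.erase_insert_of_ne hi.symm, Finset.erase_insert]
      exact fun hxi => hxU (Finset.mem_of_mem_erase hxi)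
    rw [Finset.sum_insert hxU, Finset.sum_insert hxU', if_neg (by simp), smul_zero, zero_add,
      smul_zero, zero_add] at hε
    have hL : ∑ i ∈ U, bdCoef χ (insert x U) i •
        (if x ∈ (insert x U).erase i then mono β (M ／ {x}).E (((insert x U).erase i).erase x)
          else 0) = appendSign K x U • boundary β (chiContract χ x) (M ／ {x}).E U := by
      rw [boundary_eq_sum (one_lt_card_of_dep hU.dep), Finset.smul_sum]
      refine Finset.sum_congr rfl fun i hi => ?_
      rw [if_pos (by simp [hne hxU i hi]), herase i (hne hxU i hi).symm, bdCoef_insert χ hxU hi,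
        smul_smul]
    have hsd : insert x U \ insert x U' = U \ U' := by
      ext j
      simp only [Finset.mem_sdiff, Finset.mem_insert]
      by_cases hj : j = x
      · subst hj
        tauto
      · tauto
    have hR : ∑ i ∈ U', (bdCoef χ (insert x U') i *
          (sortCoef β ((insert x U').erase i) (insert x U \ insert x U') : K)) •
        (if x ∈ (insert x U).erase i then mono β (M ／ {x}).E (((insert x U).erase i).erase x)
          else 0) = (appendSign K x U' * (sortCoef β {x} (U \ U') : K)) •
          (boundary β (chiContract χ x) (M ／ {x}).E U' * mono β (M ／ {x}).E (U \ U')) := by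
      rw [boundary_mul_mono (one_lt_card_of_dep hU'.dep) h, Finset.smul_sum]
      refine Finset.sum_congr rfl fun i hi => ?_
      have hix := hne hxU' i hi
      rw [if_pos (by simp [hix]), herase i hix.symm, bdCoef_insert χ hxU' hi,
        smul_smul, hsd, Finset.erase_insert_of_ne hix,
        sortCoef_insert (fun hxi => hxU' (Finset.mem_of_mem_erase hxi)), Units.val_mul]
      congr 1
      ring
    rw [hL, hR, smul_smul] at hε
    have hne0 : appendSign K x U * ((ε : K) * (appendSign K x U' * (sortCoef β {x} (U \ U') : K)))
        ≠ 0 :=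
      mul_ne_zero (appendSign_ne_zero x U)
        (mul_ne_zero ε.ne_zero (mul_ne_zero (appendSign_ne_zero x U') (Units.ne_zero _)))
    refine ⟨Units.mk0 _ hne0, ?_⟩
    rw [Units.val_mk0, mul_smul, ← hε, smul_smul, appendSign_mul_self, one_smul]

end Minors

/-! ### No-broken-circuit sets and injectivity of the inclusion -/

section NoBrokenCircuit

variable {N : Matroid α} {β : α → α → Kˣ} {χ : Finset α → K} {w : α → ℕ}

/-- `I` contains no broken circuit, where a circuit is broken by removing its element of least
weight. -/
def IsNbc (N : Matroid α) (w : α → ℕ) (I : Finset α) : Prop :=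
  N.Indep (I : Set α) ∧ ∀ c ∈ N.E, c ∉ I → c ∉ N.closure {i | i ∈ I ∧ w c < w i}

/-- Straightening: if heavier elements of `X` span some `c ∉ X`, the relation of `X ∪ c` rewrites
`e_X` through the `e_{X ∪ c ∖ i}`. Each independent set among these omits an `i` heavier than `c`,
so the total weight drops. -/
theorem cls_mem_span_nbc [N.Loopless] (hχ : IsChi N β χ) (w : α → ℕ) (X : Finset α)
    (hX : N.Indep (X : Set α)) :
    cls N β χ X ∈ Submodule.span K (cls N β χ '' {J | IsNbc N w J}) := by
  induction hn : ∑ i ∈ X, w i using Nat.strong_induction_on generalizing X with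
  | _ n ih =>
  subst hn
  by_cases hnbc : IsNbc N w X
  · exact Submodule.subset_span ⟨X, hnbc, rfl⟩
  simp only [IsNbc, hX, true_and, not_forall, not_not] at hnbc
  obtain ⟨c, hcE, hcX, hc⟩ := hnbc
  obtain ⟨C, hCsub, hC, -⟩ := Matroid.exists_isCircuit_of_mem_closure hc
    (fun h => hcX h.1)
  have hUE : ((insert c X : Finset α) : Set α) ⊆ N.E := by
    rw [Finset.coe_insert]
    exact Set.insert_subset hcE hX.subset_ground
  have hUX : (insert c X).erase c = X := Finset.erase_insert hcX
  have hCU : C ⊆ ((insert c X : Finset α) : Set α) := by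
    rw [Finset.coe_insert]
    exact hCsub.trans (Set.insert_subset_insert fun i hi => hi.1)
  have hU : IsUnidep N (insert c X) :=
    isUnidep_iff.2 ⟨hC.dep.superset hCU hUE, c, by simp, by rwa [hUX]⟩
  have hsum := sum_cls_eq_zero hχ hU
  rw [Finset.sum_insert hcX, hUX] at hsum
  have hne : bdCoef χ (insert c X) c ≠ 0 := by
    rw [bdCoef, hUX]
    exact mul_ne_zero (pow_ne_zero _ (neg_ne_zero.2 one_ne_zero))
      ((hχ.ne_zero_iff X hX.subset_ground).2 hX)
  rw [← Submodule.smul_mem_iff _ hne, eq_neg_of_add_eq_zero_left hsum]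
  refine Submodule.neg_mem _ (Submodule.sum_mem _ fun i hi => Submodule.smul_mem _ _ ?_)
  have hiE : (((insert c X).erase i : Finset α) : Set α) ⊆ N.E :=
    (Finset.coe_subset.2 (Finset.erase_subset _ _)).trans hUE
  by_cases hind : N.Indep (((insert c X).erase i : Finset α) : Set α)
  · refine ih _ ?_ _ hind rfl
    have hwi : w c < w i := by
      by_contra hwi
      refine hC.dep.not_indep (hind.subset fun j hj => ?_)
      rw [Finset.mem_coe, Finset.mem_erase]
      refine ⟨?_, hCU hj⟩
      rintro rfl
      rcases hCsub hj with rfl | h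
      · exact hcX hi
      · exact hwi h.2
    have h1 := Finset.add_sum_erase (insert c X) w (Finset.mem_insert_of_mem hi)
    rw [Finset.sum_insert hcX] at h1
    omega
  · rw [cls_eq_zero hχ ((N.not_indep_iff hiE).1 hind)]
    exact Submodule.zero_mem _

theorem span_nbc [N.Loopless] (hχ : IsChi N β χ) (w : α → ℕ) :
    Submodule.span K (cls N β χ '' {J | IsNbc N w J}) = ⊤ := by
  rw [eq_top_iff, ← span_cls hχ, Submodule.span_le]
  rintro _ ⟨I, hI, rfl⟩
  exact cls_mem_span_nbc hχ w I hI

open Classical in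
/-- The level of `e` in the flag of the closures of the upper sets of `I` with respect to the
weight: the greatest `t` such that the elements of `I` of weight at least `t` span `e`. -/
def level (N : Matroid α) (w : α → ℕ) (I : Finset α) (e : α) : ℕ :=
  Nat.findGreatest (fun t => e ∈ N.closure {i | i ∈ I ∧ t ≤ w i}) (I.sup w)

/-- Level `0` is also the default of `Nat.findGreatest` when nothing is found, hence the hypothesis.
-/
theorem mem_closure_level {I : Finset α} {e : α} (h : level N w I e ≠ 0) :
    e ∈ N.closure {i | i ∈ I ∧ level N w I e ≤ w i} := by
  classical
  exact Nat.findGreatest_of_ne_zero (P := fun t => e ∈ N.closure {i | i ∈ I ∧ t ≤ w i}) rfl h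

theorem le_level [N.Loopless] {I : Finset α} {e : α} {t : ℕ}
    (h : e ∈ N.closure {i | i ∈ I ∧ t ≤ w i}) : t ≤ level N w I e := by
  classical
  by_cases ht : t ≤ I.sup w
  · exact Nat.le_findGreatest ht h
  -- Beyond the search bound the spanning set is empty, and without loops it spans nothing.
  · have h0 : {i | i ∈ I ∧ t ≤ w i} = ∅ :=
      Set.eq_empty_of_forall_notMem fun i hi => ht (hi.2.trans (Finset.le_sup hi.1))
    rw [h0, N.closure_empty, N.loops_eq_empty] at h
    exact h.elim

theorem level_of_mem [N.Loopless] {I : Finset α} (hI : N.Indep (I : Set α)) {i : α} (hi : i ∈ I) :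
    level N w I i = w i := by
  refine le_antisymm ?_ (le_level (N.mem_closure_of_mem' ⟨hi, le_rfl⟩ (hI.subset_ground hi)))
  by_contra! h
  refine hI.notMem_closure_sdiff_of_mem hi
    (N.closure_subset_closure ?_ (mem_closure_level (by omega : level N w I i ≠ 0)))
  rintro j ⟨hj, hwj⟩
  refine ⟨hj, ?_⟩
  rintro rfl
  omega

/-- If the level were not a weight occurring in `I`, raising the threshold by one would not change
the upper set. -/
theorem level_mem_image [N.Loopless] (hw : ∀ e ∈ N.E, w e ≠ 0) {I : Finset α}
    (hI : N.Indep (I : Set α)) {e : α} (he : e ∈ N.closure (I : Set α)) :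
    level N w I e ∈ I.image w := by
  have h1 : 1 ≤ level N w I e := by
    refine le_level (N.closure_subset_closure ?_ he)
    exact fun i hi => ⟨hi, Nat.one_le_iff_ne_zero.2 (hw i (hI.subset_ground hi))⟩
  by_contra h
  have h2 : level N w I e + 1 ≤ level N w I e := by
    refine le_level (N.closure_subset_closure ?_ (mem_closure_level (by omega : level N w I e ≠ 0)))
    rintro i ⟨hi, hwi⟩
    refine ⟨hi, Nat.succ_le_of_lt (lt_of_le_of_ne hwi ?_)⟩
    rintro heq
    exact h (Finset.mem_image.2 ⟨i, hi, heq.symm⟩)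
  omega

/-- The elements of `X` lie one in each step of the flag of `I`. -/
def IsAdapted (N : Matroid α) (w : α → ℕ) (I X : Finset α) : Prop :=
  Set.InjOn (level N w I) X ∧ X.image (level N w I) = I.image w

theorem isAdapted_self [N.Loopless] (hw : Set.InjOn w N.E) {I : Finset α}
    (hI : N.Indep (I : Set α)) : IsAdapted N w I I := by
  have h : ∀ i ∈ I, level N w I i = w i := fun i hi => level_of_mem hI hi
  refine ⟨fun i hi j hj hij => ?_, Finset.image_congr h⟩
  rw [h i hi, h j hj] at hij
  exact hw (hI.subset_ground hi) (hI.subset_ground hj) hij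

theorem IsAdapted.level_ne_zero (hw : ∀ e ∈ N.E, w e ≠ 0) {I X : Finset α}
    (hI : N.Indep (I : Set α)) (hX : IsAdapted N w I X) {e : α} (he : e ∈ X) :
    level N w I e ≠ 0 := by
  have h := Finset.mem_image_of_mem (level N w I) he
  rw [hX.2] at h
  obtain ⟨i, hi, hie⟩ := Finset.mem_image.1 h
  rw [← hie]
  exact hw i (hI.subset_ground hi)

/-- Add elements by decreasing level: those already present lie in a flat of the flag that excludes
the next one. -/
theorem IsAdapted.indep [N.Loopless] (hw : ∀ e ∈ N.E, w e ≠ 0) {I X : Finset α}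
    (hI : N.Indep (I : Set α)) (hXE : (X : Set α) ⊆ N.E) (hX : IsAdapted N w I X) :
    N.Indep (X : Set α) := by
  have key : ∀ Y : Finset α, Y ⊆ X → N.Indep (Y : Set α) := by
    intro Y
    induction Y using Finset.induction_on_min_value (level N w I) with
    | empty => simp
    | insert a s ha hmin ih =>
      intro hs
      have hs' : s ⊆ X := (Finset.subset_insert a s).trans hs
      have haX : a ∈ X := hs (Finset.mem_insert_self a s)
      rw [Finset.coe_insert]
      refine ((ih hs').notMem_closure_iff (hXE haX)).1 (fun hcl => ?_) |>.1
      have hsub : (s : Set α) ⊆ N.closure {i | i ∈ I ∧ level N w I a + 1 ≤ w i} := by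
        intro b hb
        refine N.closure_subset_closure ?_
          (mem_closure_level (hX.level_ne_zero hw hI (hs' hb)))
        rintro i ⟨hi, hwi⟩
        refine ⟨hi, le_trans (Nat.succ_le_of_lt (lt_of_le_of_ne (hmin b hb) fun heq => ?_)) hwi⟩
        exact ha (hX.1 haX (hs' hb) heq ▸ hb)
      have := le_level (N.closure_subset_closure_of_subset_closure hsub hcl)
      omega
  exact key X subset_rfl

/-- Number of pairs of elements of `X` whose levels are in the opposite order. -/
def levelInv (f : α → ℕ) (X : Finset α) : ℕ :=
  ∑ c ∈ X, ∑ d ∈ X, if c < d ∧ f d < f c then 1 else 0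

/-- The identity holds for each `d ∈ Y` separately. It is used modulo 2; the additive form avoids
truncated subtraction. -/
theorem levelInv_insert (f : α → ℕ) {i : α} {Y : Finset α} (hi : i ∉ Y) :
    levelInv f (insert i Y) + ((insert i Y).filter fun c => f c < f i).card +
      ((insert i Y).filter fun c => c ≤ i ∧ f c = f i).card =
    levelInv f Y + ((insert i Y).filter fun c => c ≤ i).card +
      2 * (Y.filter fun c => i < c ∧ f c < f i).card := by
  simp only [levelInv, Finset.card_filter, Finset.sum_insert hi, Finset.sum_add_distrib, lt_irrefl,
    le_refl, and_self, if_true, if_false]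
  have h : ∑ d ∈ Y, (if i < d ∧ f d < f i then 1 else 0) +
      ∑ d ∈ Y, (if d < i ∧ f i < f d then 1 else 0) + ∑ d ∈ Y, (if f d < f i then 1 else 0) +
      ∑ d ∈ Y, (if d ≤ i ∧ f d = f i then 1 else 0) =
      ∑ d ∈ Y, (if d ≤ i then 1 else 0) + 2 * ∑ d ∈ Y, (if i < d ∧ f d < f i then 1 else 0) := by
    rw [Finset.mul_sum, ← Finset.sum_add_distrib, ← Finset.sum_add_distrib,
      ← Finset.sum_add_distrib, ← Finset.sum_add_distrib]
    refine Finset.sum_congr rfl fun d hd => ?_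
    have hdi : d ≠ i := fun h => hi (h ▸ hd)
    rcases lt_or_gt_of_ne hdi with h | h <;> rcases lt_trichotomy (f d) (f i) with h' | h' | h'
    all_goals simp [h, h', h.le, h.not_gt, h.not_ge, not_lt_of_gt, ne_of_gt, ne_of_lt]
  omega

theorem neg_one_pow_levelInv_erase (f : α → ℕ) {i : α} {U : Finset α} (hi : i ∈ U) :
    (-1 : K) ^ (U.filter fun c => c ≤ i).card * (-1) ^ levelInv f (U.erase i) =
      (-1) ^ (levelInv f U + (U.filter fun c => f c < f i).card +
        (U.filter fun c => c ≤ i ∧ f c = f i).card) := by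
  have h := levelInv_insert f (Finset.notMem_erase i U)
  rw [Finset.insert_erase hi] at h
  rw [h, pow_add _ _ (2 * _), pow_mul]
  simp [pow_add, mul_comm]

/-- By the parity formula the two terms differ only in the count of ties, which is 1 for the smaller
of `a`, `b` and 2 for the larger. -/
theorem neg_one_pow_levelInv_cancel (f : α → ℕ) {a b : α} {U : Finset α} (ha : a ∈ U) (hb : b ∈ U)
    (hab : a ≠ b) (hf : f a = f b) (hinj : Set.InjOn f (U.erase a : Finset α)) :
    (-1 : K) ^ (U.filter fun c => c ≤ a).card * (-1) ^ levelInv f (U.erase a) +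
      (-1) ^ (U.filter fun c => c ≤ b).card * (-1) ^ levelInv f (U.erase b) = 0 := by
  have hfib : ∀ c ∈ U, f c = f a → c = a ∨ c = b := by
    intro c hc hca
    by_contra! h
    exact h.2 (hinj (by simp [hc, h.1]) (by simp [hb, hab.symm]) (hca.trans hf))
  rw [neg_one_pow_levelInv_erase f ha, neg_one_pow_levelInv_erase f hb, ← hf]
  rcases lt_or_gt_of_ne hab with h | h
  · have h1 : (U.filter fun c => c ≤ a ∧ f c = f a) = {a} := by
      ext c
      simp only [Finset.mem_filter, Finset.mem_singleton]
      refine ⟨fun hc => (hfib c hc.1 hc.2.2).resolve_right fun hcb => ?_, ?_⟩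
      · exact absurd (hcb ▸ hc.2.1) h.not_ge
      · rintro rfl
        exact ⟨ha, le_rfl, rfl⟩
    have h2 : (U.filter fun c => c ≤ b ∧ f c = f a) = {a, b} := by
      ext c
      simp only [Finset.mem_filter, Finset.mem_insert, Finset.mem_singleton]
      refine ⟨fun hc => hfib c hc.1 hc.2.2, ?_⟩
      rintro (rfl | rfl)
      · exact ⟨ha, h.le, rfl⟩
      · exact ⟨hb, le_rfl, hf.symm⟩
    rw [h1, h2, Finset.card_singleton, Finset.card_pair hab]
    ring
  · have h1 : (U.filter fun c => c ≤ b ∧ f c = f a) = {b} := by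
      ext c
      simp only [Finset.mem_filter, Finset.mem_singleton]
      refine ⟨fun hc => (hfib c hc.1 hc.2.2).resolve_left fun hca => ?_, ?_⟩
      · exact absurd (hca ▸ hc.2.1) h.not_ge
      · rintro rfl
        exact ⟨hb, le_rfl, hf.symm⟩
    have h2 : (U.filter fun c => c ≤ a ∧ f c = f a) = {a, b} := by
      ext c
      simp only [Finset.mem_filter, Finset.mem_insert, Finset.mem_singleton]
      refine ⟨fun hc => hfib c hc.1 hc.2.2, ?_⟩
      rintro (rfl | rfl)
      · exact ⟨ha, le_rfl, rfl⟩
      · exact ⟨hb, h.le, hf.symm⟩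
    rw [h1, h2, Finset.card_singleton, Finset.card_pair hab]
    ring

open Classical in
/-- Every independent set defines a linear form on the `χ`-algebra that is supported on the sets
adapted to its flag. -/
theorem exists_flagForm [N.Loopless] (hχ : IsChi N β χ) (hw : ∀ e ∈ N.E, w e ≠ 0) {I : Finset α}
    (hI : N.Indep (I : Set α)) :
    ∃ g : ChiAlg N β χ →ₗ[K] K, ∀ X : Finset α, (X : Set α) ⊆ N.E → g (cls N β χ X) =
      if IsAdapted N w I X then (-1) ^ levelInv (level N w I) X / χ X else 0 := by
  refine exists_chiLift hχ _ ?_ ?_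
  · intro X hX
    rw [if_neg fun hA => hX.not_indep (hA.indep hw hI hX.subset_ground)]
  · intro U hU
    have hE : ∀ i, ((U.erase i : Finset α) : Set α) ⊆ N.E := fun i =>
      (Finset.coe_subset.2 (Finset.erase_subset i U)).trans hU.subset_ground
    -- Dividing by `χ` in the form cancels the factor `χ` in the boundary, leaving pure signs.
    have hterm : ∀ i, IsAdapted N w I (U.erase i) → bdCoef χ U i •
        (if IsAdapted N w I (U.erase i) then
          (-1) ^ levelInv (level N w I) (U.erase i) / χ (U.erase i) else 0) =
        (-1) ^ (U.filter fun c => c ≤ i).card * (-1) ^ levelInv (level N w I) (U.erase i) := by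
      intro i hA
      have hne : χ (U.erase i) ≠ 0 := (hχ.ne_zero_iff _ (hE i)).2 (hA.indep hw hI (hE i))
      rw [if_pos hA, bdCoef, smul_eq_mul]
      field_simp
    -- If `U ∖ a` is adapted, dependence of `U` puts `a` in the span of `I`, so `a` shares its level
    -- with some `b` in `U ∖ a`. Then exactly `U ∖ a` and `U ∖ b` are adapted, and their terms
    -- cancel.
    by_cases hex : ∃ a ∈ U, IsAdapted N w I (U.erase a)
    · obtain ⟨a, ha, hA⟩ := hex
      have hsub : ((U.erase a : Finset α) : Set α) ⊆ N.closure (I : Set α) := fun e he =>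
        N.closure_subset_closure (fun i hi => hi.1)
          (mem_closure_level (hA.level_ne_zero hw hI he))
      have hacl : a ∈ N.closure (I : Set α) := by
        refine N.closure_subset_closure_of_subset_closure hsub ?_
        by_contra hn
        have hins := (((hA.indep hw hI (hE a)).notMem_closure_iff (hU.subset_ground ha)).1 hn).1
        rw [← Finset.coe_insert, Finset.insert_erase ha] at hins
        exact hU.dep.not_indep hins
      have hlev := level_mem_image hw hI hacl
      rw [← hA.2] at hlev
      obtain ⟨b, hb, hba⟩ := Finset.mem_image.1 hlev
      obtain ⟨hbne, hbU⟩ := Finset.mem_erase.1 hb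
      have hB : IsAdapted N w I (U.erase b) := by
        constructor
        · intro c hc d hd hcd
          rw [Finset.coe_erase] at hc hd
          have key : ∀ c ∈ (U : Set α) \ {b}, c ≠ a → level N w I c ≠ level N w I a := by
            intro c hc hca heq
            exact hc.2 (hA.1 (by simp [hca, Finset.mem_coe.1 hc.1]) hb (heq.trans hba.symm))
          by_cases hca : c = a
          · by_contra hne
            exact key d hd (fun h => hne (hca.trans h.symm)) (hca ▸ hcd.symm)
          · by_cases hda : d = a
            · exact absurd (hda ▸ hcd) (key c hc hca)
            · exact hA.1 (by simp [hca, Finset.mem_coe.1 hc.1])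
                (by simp [hda, Finset.mem_coe.1 hd.1]) hcd
        · rw [← hA.2]
          ext t
          simp only [Finset.mem_image, Finset.mem_erase]
          constructor
          · rintro ⟨c, ⟨hcb, hcU⟩, rfl⟩
            by_cases hca : c = a
            · exact ⟨b, ⟨hbne, hbU⟩, hca ▸ hba⟩
            · exact ⟨c, ⟨hca, hcU⟩, rfl⟩
          · rintro ⟨c, ⟨hca, hcU⟩, rfl⟩
            by_cases hcb : c = b
            · exact ⟨a, ⟨hbne.symm, ha⟩, hcb ▸ hba.symm⟩
            · exact ⟨c, ⟨hcb, hcU⟩, rfl⟩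
      rw [← Finset.add_sum_erase U _ ha, ← Finset.add_sum_erase _ _ hb, hterm a hA, hterm b hB,
        Finset.sum_eq_zero, add_zero]
      · exact neg_one_pow_levelInv_cancel _ ha hbU hbne.symm hba.symm hA.1
      · intro i hi
        simp only [Finset.mem_erase] at hi
        rw [if_neg, smul_zero]
        intro hC
        exact hbne (hC.1 (by simp [hi.1.symm, hbU]) (by simp [hi.2.1.symm, ha]) hba)
    · push Not at hex
      refine Finset.sum_eq_zero fun i hi => ?_
      rw [if_neg (hex i hi), smul_zero]

/-- Let `i ∈ I ∖ J` and let `F` be the flat spanned by the elements of `I` of weight at least `w i`.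
By counting, the elements of `J` of level at least `w i` span `F`, so they span `i`. If all are
heavier than `i`, then `J` contains a broken circuit; otherwise a lighter `c ∈ F` outside `I` shows
that `I` does. So `I ⊆ J`, and the cardinalities agree. -/
theorem IsNbc.eq_of_isAdapted [N.Loopless] (hw : Set.InjOn w N.E) (hw0 : ∀ e ∈ N.E, w e ≠ 0)
    {I J : Finset α} (hI : IsNbc N w I) (hJ : IsNbc N w J) (h : IsAdapted N w I J) : J = I := by
  have hcard : ∀ t, (J.filter fun e => t ≤ level N w I e).card =
      (I.filter fun i => t ≤ w i).card := by
    intro t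
    rw [← Finset.card_image_of_injOn (h.1.mono (Finset.coe_subset.2 (Finset.filter_subset _ J))),
      ← Finset.card_image_of_injOn
        (hw.mono ((Finset.coe_subset.2 (Finset.filter_subset _ I)).trans hI.1.subset_ground)),
      ← Finset.filter_image, ← Finset.filter_image, h.2]
  have hsub : I ⊆ J := by
    intro i hi
    by_contra hiJ
    have hJt : ∀ e ∈ J, w i ≤ level N w I e → e ∈ N.closure {k | k ∈ I ∧ w i ≤ w k} := by
      intro e he hle
      refine N.closure_subset_closure ?_ (mem_closure_level (h.level_ne_zero hw0 hI.1 he))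
      exact fun k hk => ⟨hk.1, hle.trans hk.2⟩
    have hiE := hI.1.subset_ground hi
    have hJi : N.Indep ((J.filter fun e => w i ≤ level N w I e : Finset α) : Set α) :=
      hJ.1.subset (Finset.coe_subset.2 (Finset.filter_subset _ J))
    have hIi : N.Indep ((I.filter fun k => w i ≤ w k : Finset α) : Set α) :=
      hI.1.subset (Finset.coe_subset.2 (Finset.filter_subset _ I))
    have hcl : i ∈ N.closure ((J.filter fun e => w i ≤ level N w I e : Finset α) : Set α) := by
      by_contra hn
      have hins := ((hJi.notMem_closure_iff hiE).1 hn).1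
      rw [← Finset.coe_insert] at hins
      obtain ⟨e, he, heI⟩ := hIi.augment hins (by
        rw [Set.encard_coe_eq_coe_finsetCard, Set.encard_coe_eq_coe_finsetCard,
          Finset.card_insert_of_notMem (by simp [hiJ]), hcard]
        exact_mod_cast Nat.lt_succ_self _)
      have hecl : e ∈ N.closure ((I.filter fun k => w i ≤ w k : Finset α) : Set α) := by
        rw [Finset.coe_filter]
        rcases Finset.mem_insert.1 (Finset.mem_coe.1 he.1) with rfl | heJ
        · exact N.mem_closure_of_mem' ⟨hi, le_rfl⟩ hiE
        · exact hJt e (Finset.mem_filter.1 heJ).1 (Finset.mem_filter.1 heJ).2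
      exact ((hIi.notMem_closure_iff (heI.subset_ground (Set.mem_insert _ _))).2
        ⟨heI, he.2⟩) hecl
    by_cases hall : ∀ c ∈ J, w i ≤ level N w I c → w i < w c
    · refine hJ.2 i hiE hiJ (N.closure_subset_closure ?_ hcl)
      intro c hc
      rw [Finset.coe_filter] at hc
      exact ⟨hc.1, hall c hc.1 hc.2⟩
    · push Not at hall
      obtain ⟨c, hcJ, hle, hwc⟩ := hall
      have hcE := hJ.1.subset_ground hcJ
      have hlt : w c < w i := lt_of_le_of_ne hwc fun heq => hiJ (hw hcE hiE heq ▸ hcJ)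
      have hcI : c ∉ I := fun hcI => by
        rw [level_of_mem hI.1 hcI] at hle
        omega
      refine hI.2 c hcE hcI (N.closure_subset_closure ?_ (hJt c hcJ hle))
      exact fun k hk => ⟨hk.1, hlt.trans_le hk.2⟩
  have h0 := hcard 0
  simp only [zero_le, Finset.filter_true] at h0
  exact (Finset.eq_of_subset_of_card_le hsub h0.le).symm

/-- Only `c = x` is a new test, and no element is heavier than `x`. -/
theorem isNbc_of_isNbc_delete {M : Matroid α} [M.Loopless] {x : α}
    (hx : ∀ y ∈ M.E, w y ≤ w x) {J : Finset α} (hJ : IsNbc (M ＼ {x}) w J) : IsNbc M w J := by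
  have hind := (Matroid.delete_indep_iff.1 hJ.1)
  refine ⟨hind.1, fun c hcE hcJ hcl => ?_⟩
  by_cases hcx : c = x
  · subst hcx
    have h0 : {i | i ∈ J ∧ w c < w i} = ∅ := Set.eq_empty_of_forall_notMem fun i hi =>
      (hx i (hind.1.subset_ground hi.1)).not_gt hi.2
    rw [h0, M.closure_empty, M.loops_eq_empty] at hcl
    exact hcl
  · refine hJ.2 c (by simpa using And.intro hcE hcx) hcJ ?_
    rw [Matroid.delete_closure_eq_of_disjoint]
    · exact Set.mem_sdiff_singleton.2 ⟨hcl, hcx⟩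
    · exact hind.2.mono_left fun i hi => hi.1

theorem exists_weight {E : Set α} (hE : E.Finite) (x : α) :
    ∃ w : α → ℕ, Set.InjOn w E ∧ (∀ e ∈ E, w e ≠ 0) ∧ ∀ y ∈ E, w y ≤ w x := by
  obtain ⟨f, hf⟩ := Set.countable_iff_exists_injOn.1 hE.countable
  obtain ⟨B, hB⟩ := (hE.image f).bddAbove
  have hlt : ∀ y ∈ E, f y ≤ B := fun y hy => hB (Set.mem_image_of_mem f hy)
  refine ⟨fun y => if y = x then B + 2 else f y + 1, ?_, ?_, ?_⟩
  · intro y hy z hz h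
    have hy' := hlt y hy
    have hz' := hlt z hz
    dsimp only at h
    split_ifs at h with h1 h2 h2
    · exact h1.trans h2.symm
    · omega
    · omega
    · exact hf hy hz (by omega)
  · intro y _
    dsimp only
    split_ifs <;> omega
  · intro y hy
    have hy' := hlt y hy
    simp only [if_true]
    split_ifs <;> omega

theorem injective_of_isInclusion {M : Matroid α} [M.Finite] [M.Loopless] (hχ : IsChi M β χ) {x : α}
    {f : DelAlg M β χ x →ₗ[K] ChiAlg M β χ} (hf : IsInclusion M β χ x f) :
    Function.Injective f := by
  have := loopless_delete (M := M) (x := x)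
  obtain ⟨w, hw, hw0, hwx⟩ := exists_weight M.ground_finite x
  refine (injective_iff_map_eq_zero f).2 fun z hz => ?_
  have hmem : z ∈ Submodule.span K (cls (M ＼ {x}) β χ '' {J | IsNbc (M ＼ {x}) w J}) := by
    rw [span_nbc (hχ.delete x) w]
    trivial
  obtain ⟨l, hl, rfl⟩ := (Finsupp.mem_span_image_iff_linearCombination K).1 hmem
  have hnbc : ∀ J ∈ l.support, IsNbc (M ＼ {x}) w J := fun J hJ => hl hJ
  suffices hl0 : l = 0 by rw [hl0, map_zero]
  ext I
  by_contra hlI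
  have hIs : I ∈ l.support := Finsupp.mem_support_iff.2 hlI
  have hI := isNbc_of_isNbc_delete hwx (hnbc I hIs)
  -- The flag form of `I` annihilates every other no-broken-circuit term, so it isolates the
  -- coefficient of `I`.
  obtain ⟨g, hg⟩ := exists_flagForm (w := w) hχ hw0 hI.1
  have hgz := congrArg g hz
  rw [Finsupp.linearCombination_apply, Finsupp.sum, map_sum, map_sum, map_zero,
    Finset.sum_eq_single_of_mem I hIs, map_smul, map_smul, hf I (hnbc I hIs).1,
    hg I hI.1.subset_ground, if_pos (isAdapted_self hw hI.1), smul_eq_mul] at hgz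
  · refine mul_ne_zero hlI (div_ne_zero (pow_ne_zero _ (neg_ne_zero.2 one_ne_zero)) ?_) hgz
    exact (hχ.ne_zero_iff I hI.1.subset_ground).2 hI.1
  · intro J hJ hJI
    have hJ' := isNbc_of_isNbc_delete hwx (hnbc J hJ)
    rw [map_smul, map_smul, hf J (hnbc J hJ).1, hg J hJ'.1.subset_ground, if_neg, smul_zero]
    exact fun hA => hJI (hI.eq_of_isAdapted hw hw0 hJ' hA)

end NoBrokenCircuit

/-! ### The two maps, exactness and splitting -/

section ExactSequence

variable {M : Matroid α} {β : α → α → Kˣ} {χ : Finset α → K} {x : α}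

theorem exists_isInclusion [M.Loopless] (hχ : IsChi M β χ) (x : α) :
    ∃ f : DelAlg M β χ x →ₗ[K] ChiAlg M β χ, IsInclusion M β χ x f := by
  have := loopless_delete (M := M) (x := x)
  obtain ⟨f, hf⟩ := exists_chiLift (hχ.delete x) (cls M β χ)
    (fun X hX => cls_eq_zero hχ (Matroid.delete_dep_iff.1 hX).1)
    (fun U hU => sum_cls_eq_zero hχ (isUnidep_delete_iff.1 hU).2)
  exact ⟨f, fun I hI => hf I hI.subset_ground⟩

open Classical in
theorem exists_residue [M.Loopless] [(M ／ {x}).Loopless] (hχ : IsChi M β χ) (hx : x ∈ M.E) :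
    ∃ f : ChiAlg M β χ →ₗ[K] ConAlg M β χ x, ∀ X : Finset α, (X : Set α) ⊆ M.E →
      f (cls M β χ X) =
        if x ∈ X then cls (M ／ {x}) β (chiContract χ x) (X.erase x) else 0 := by
  refine exists_chiLift hχ _ ?_ ?_
  · intro X hX
    split_ifs with hxX
    · refine cls_eq_zero (hχ.contract hx) ((dep_contract_iff hx).2 ⟨Finset.notMem_erase x X, ?_⟩)
      rwa [Finset.insert_erase hxX]
    · rfl
  · intro U hU
    -- For `x ∈ U` the relation becomes, up to sign, that of `U ∖ x` in the contraction; for `x ∉ U`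
    -- every term vanishes.
    by_cases hxU : x ∈ U
    · have hx' : x ∉ U.erase x := Finset.notMem_erase x U
      have hUx : insert x (U.erase x) = U := Finset.insert_erase hxU
      have hU' : IsUnidep (M ／ {x}) (U.erase x) :=
        (isUnidep_contract_iff hx).2 ⟨hx', by rwa [hUx]⟩
      rw [← Finset.add_sum_erase U _ hxU, if_neg hx', smul_zero, zero_add,
        ← smul_zero (appendSign K x (U.erase x)), ← sum_cls_eq_zero (hχ.contract hx) hU',
        Finset.smul_sum]
      refine Finset.sum_congr rfl fun i hi => ?_
      have h := bdCoef_insert χ hx' hi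
      rw [hUx] at h
      rw [h, if_pos (Finset.mem_erase.2 ⟨(Finset.ne_of_mem_erase hi).symm, hxU⟩), smul_smul,
        Finset.erase_right_comm]
    · refine Finset.sum_eq_zero fun i _ => ?_
      rw [if_neg (fun h => hxU (Finset.mem_of_mem_erase h)), smul_zero]

theorem isResidue_iff (hM : IsSimple M) {f : ChiAlg M β χ →ₗ[K] ConAlg M β χ x} :
    IsResidue M β χ x f ↔ ∀ I : Finset α, M.Indep (I : Set α) →
      f (cls M β χ I) =
        if x ∈ I then cls (M ／ {x}) β (chiContract χ x) (I.erase x) else 0 := by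
  refine forall₂_congr fun I hI => ?_
  constructor
  · rintro ⟨h1, -, h3⟩
    split_ifs with hx
    · exact h1 hx
    · exact h3 hx fun y _ => hM.2 x y
  · intro h
    refine ⟨fun hx => by rw [h, if_pos hx], fun y _ hy => absurd hy (hM.2 x y),
      fun hx _ => by rw [h, if_neg hx]⟩

/-- The section of the residue map modulo the image of the inclusion map. -/
theorem exists_section_mod [M.Loopless] [(M ／ {x}).Loopless] (hχ : IsChi M β χ) (hx : x ∈ M.E)
    {W : Submodule K (ChiAlg M β χ)}
    (hW : ∀ I : Finset α, M.Indep (I : Set α) → x ∉ I → cls M β χ I ∈ W) :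
    ∃ q : ConAlg M β χ x →ₗ[K] ChiAlg M β χ ⧸ W, ∀ X : Finset α,
      (X : Set α) ⊆ (M ／ {x}).E →
        q (cls (M ／ {x}) β (chiContract χ x) X) = W.mkQ (cls M β χ (insert x X)) := by
  refine exists_chiLift (hχ.contract hx) (fun X => W.mkQ (cls M β χ (insert x X))) ?_ ?_
  · intro X hX
    rw [cls_eq_zero hχ ((dep_contract_iff hx).1 hX).2, map_zero]
  · intro U hU
    obtain ⟨hxU, hUx⟩ := (isUnidep_contract_iff hx).1 hU
    have hsum := congrArg W.mkQ (sum_cls_eq_zero hχ hUx)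
    -- This is the term omitting `x` in the relation of `U ∪ x`, the only one absent from the
    -- relation of `U` in the contraction.
    have hU0 : W.mkQ (cls M β χ U) = 0 := by
      by_cases hI : M.Indep (U : Set α)
      · exact (Submodule.Quotient.mk_eq_zero W).2 (hW U hI hxU)
      · have hUE : (U : Set α) ⊆ M.E :=
          (Finset.coe_subset.2 (Finset.subset_insert x U)).trans hUx.subset_ground
        rw [cls_eq_zero hχ ((M.not_indep_iff hUE).1 hI), map_zero]
    rw [Finset.sum_insert hxU, Finset.erase_insert hxU, map_add, map_smul, hU0, smul_zero,
      zero_add, map_sum, map_zero] at hsum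
    rw [← smul_right_injective _ (appendSign_ne_zero (K := K) x U) |>.eq_iff, smul_zero,
      Finset.smul_sum, ← hsum]
    refine Finset.sum_congr rfl fun i hi => ?_
    have hix : x ≠ i := fun h => hxU (h ▸ hi)
    rw [smul_smul, ← bdCoef_insert χ hxU hi, Finset.erase_insert_of_ne hix, map_smul]

theorem exact_inclusion_residue [(M ／ {x}).Loopless] (hM : IsSimple M) (hχ : IsChi M β χ)
    (hx : x ∈ M.E) {i : DelAlg M β χ x →ₗ[K] ChiAlg M β χ} (hi : IsInclusion M β χ x i)
    {p : ChiAlg M β χ →ₗ[K] ConAlg M β χ x} (hp : IsResidue M β χ x p) :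
    Function.Exact i p := by
  have := hM.loopless
  have := loopless_delete (M := M) (x := x)
  rw [isResidue_iff hM] at hp
  obtain ⟨q, hq⟩ := exists_section_mod hχ hx (W := LinearMap.range i) fun I hI hxI =>
    ⟨_, hi I (Matroid.delete_indep_iff.2 ⟨hI, by simpa using hxI⟩)⟩
  -- This factorization gives the inclusion of `ker p` in the range of `i`, without any basis.
  have hqp : q ∘ₗ p = (LinearMap.range i).mkQ := by
    refine chiAlg_hom_ext hχ fun I hI => ?_
    rw [LinearMap.comp_apply, hp I hI]
    split_ifs with hxI
    · rw [hq, Finset.insert_erase hxI]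
      rw [Matroid.contract_ground, Finset.coe_erase]
      exact Set.sdiff_subset_sdiff_left hI.subset_ground
    · rw [map_zero, eq_comm]
      exact (Submodule.Quotient.mk_eq_zero _).2
        ⟨_, hi I (Matroid.delete_indep_iff.2 ⟨hI, by simpa using hxI⟩)⟩
  have hpi : p ∘ₗ i = 0 := by
    refine chiAlg_hom_ext (hχ.delete x) fun I hI => ?_
    have hI' := Matroid.delete_indep_iff.1 hI
    rw [LinearMap.comp_apply, hi I hI, hp I hI'.1, if_neg (by simpa using hI'.2),
      LinearMap.zero_apply]
  intro z
  constructor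
  · intro hz
    have h := LinearMap.congr_fun hqp z
    rw [LinearMap.comp_apply, hz, map_zero, eq_comm] at h
    exact (Submodule.Quotient.mk_eq_zero _).1 h
  · rintro ⟨y, rfl⟩
    exact LinearMap.congr_fun hpi y

theorem surjective_of_isResidue [M.Loopless] [(M ／ {x}).Loopless] (hχ : IsChi M β χ)
    (hx : x ∈ M.E) {p : ChiAlg M β χ →ₗ[K] ConAlg M β χ x} (hp : IsResidue M β χ x p) :
    Function.Surjective p := by
  rw [← LinearMap.range_eq_top, eq_top_iff, ← span_cls (hχ.contract hx), Submodule.span_le]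
  rintro _ ⟨I, hI, rfl⟩
  obtain ⟨hxI, hI'⟩ := (indep_contract_iff hx).1 hI
  refine ⟨cls M β χ (insert x I), ?_⟩
  rw [(hp _ hI').1 (Finset.mem_insert_self x I), Finset.erase_insert hxI]

/-- A short exact sequence of vector spaces splits. -/
theorem exists_splitting {A B C : Type*} [AddCommGroup A] [Module K A] [AddCommGroup B]
    [Module K B] [AddCommGroup C] [Module K C] {i : A →ₗ[K] B} {p : B →ₗ[K] C}
    (hi : Function.Injective i) (hip : Function.Exact i p) (hp : Function.Surjective p) :
    ∃ (r : B →ₗ[K] A) (s : C →ₗ[K] B), r ∘ₗ i = LinearMap.id ∧ p ∘ₗ s = LinearMap.id ∧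
      i ∘ₗ r + s ∘ₗ p = LinearMap.id := by
  obtain ⟨s, hs⟩ := p.exists_rightInverse_of_surjective (LinearMap.range_eq_top.2 hp)
  have hmem : ∀ b, (LinearMap.id - s ∘ₗ p : B →ₗ[K] B) b ∈ LinearMap.range i := fun b => by
    refine (hip _).1 ?_
    have h := LinearMap.congr_fun hs (p b)
    simp only [LinearMap.comp_apply, LinearMap.id_apply] at h
    simp [h]
  have hr : ∀ b, i ((LinearEquiv.ofInjective i hi).symm ⟨_, hmem b⟩) = b - s (p b) := fun b =>
    congrArg Subtype.val ((LinearEquiv.ofInjective i hi).apply_symm_apply ⟨_, hmem b⟩)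
  refine ⟨(LinearEquiv.ofInjective i hi).symm.toLinearMap ∘ₗ
    LinearMap.codRestrict _ (LinearMap.id - s ∘ₗ p) hmem, s, ?_, hs, ?_⟩
  · ext a
    refine hi ((hr (i a)).trans ?_)
    rw [hip.apply_apply_eq_zero, map_zero, sub_zero]
    rfl
  · ext b
    refine (congrArg (· + s (p b)) (hr b)).trans ?_
    simp

end ExactSequence

end ChiMatroid

end

theorem mainTheorem4 {α : Type*} [LinearOrder α] {K : Type*} [Field K]
    (M : Matroid α) [M.Finite] (hM : ChiMatroid.IsSimple M)
    (β : α → α → Kˣ) (χ : Finset α → K) (hχ : ChiMatroid.IsChi M β χ)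
    (x : α) (hx : x ∈ M.E) :
    ChiMatroid.IsChi (M ＼ {x}) β χ ∧
    ChiMatroid.IsChi (M ／ {x}) β (ChiMatroid.chiContract χ x) ∧
    ∃ (i : ChiMatroid.DelAlg M β χ x →ₗ[K] ChiMatroid.ChiAlg M β χ)
      (p : ChiMatroid.ChiAlg M β χ →ₗ[K] ChiMatroid.ConAlg M β χ x),
      (ChiMatroid.IsInclusion M β χ x i ∧
        ∀ i', ChiMatroid.IsInclusion M β χ x i' → i' = i) ∧
      (ChiMatroid.IsResidue M β χ x p ∧
        ∀ p', ChiMatroid.IsResidue M β χ x p' → p' = p) ∧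
      Function.Injective i ∧ Function.Exact i p ∧ Function.Surjective p ∧
      ∃ (r : ChiMatroid.ChiAlg M β χ →ₗ[K] ChiMatroid.DelAlg M β χ x)
        (s : ChiMatroid.ConAlg M β χ x →ₗ[K] ChiMatroid.ChiAlg M β χ),
        r ∘ₗ i = LinearMap.id ∧ p ∘ₗ s = LinearMap.id ∧
        i ∘ₗ r + s ∘ₗ p = LinearMap.id := by
  have := hM.loopless
  have := hM.loopless_contract hx
  have := ChiMatroid.loopless_delete (M := M) (x := x)
  obtain ⟨i, hi⟩ := ChiMatroid.exists_isInclusion hχ x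
  obtain ⟨p, hp'⟩ := ChiMatroid.exists_residue hχ hx
  have hp : ChiMatroid.IsResidue M β χ x p :=
    (ChiMatroid.isResidue_iff hM).2 fun I hI => by
      rw [hp' I hI.subset_ground]
  have hinj := ChiMatroid.injective_of_isInclusion hχ hi
  have hexact := ChiMatroid.exact_inclusion_residue hM hχ hx hi hp
  have hsurj := ChiMatroid.surjective_of_isResidue hχ hx hp
  refine ⟨hχ.delete x, hχ.contract hx, i, p, ⟨hi, fun i' hi' => ?_⟩, ⟨hp, fun p' hp'' => ?_⟩,
    hinj, hexact, hsurj, ChiMatroid.exists_splitting hinj hexact hsurj⟩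
  · exact ChiMatroid.chiAlg_hom_ext (hχ.delete x) fun I hI => (hi' I hI).trans (hi I hI).symm
  · rw [ChiMatroid.isResidue_iff hM] at hp hp''
    exact ChiMatroid.chiAlg_hom_ext hχ fun I hI => (hp'' I hI).trans (hp I hI).symm
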